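/- Let $K\subset\mathbb C$ be compact, non-polar and polynomially convex, put $\Omega=\mathbb C\setminus K$, and let $g_\Omega=p_\omega-I(\omega)$ be the Green's function of $\Omega$ with pole at $\infty$; here $p_\mu(z)=\int\log|z-w|\,d\mu(w)$, $I(\mu)=\int p_\mu\,d\mu$, and $\omega$ is the equilibrium measure of $K$, i.e. the Borel probability measure on $K$ of maximal energy $I$. For a polynomial $q$ of degree $n>0$ with roots $z_1,\dots,z_n$ (repeated with multiplicity) let $\mu_q=\frac1n\sum_{j=1}^n\delta_{z_j}$ be its root distribution. Let $(q_k)$ be a sequence of complex polynomials with degrees $n_k>0$, $n_k\to\infty$. We say that $(q_k)$ *centers on* $K$ if there is $N$ such that (1) there is $R>0$ such that for every $k\ge N$ all zeros of $q_k$ lie in $\{|z|<R\}$, and (2) for every closed set $L$ with $L\cap K=\emptyset$ there is $M=M(L)>0$ with $n_k\,\mu_{q_k}(L)\le M$ for all $k\ge N$. We say that $(q_k)$ is *$K$-regular* if for some $R>0$ with $K\subset\{|z|<R\}$ one has $\frac1{n_k}\log|q_k|\to g_\Omega$ uniformly on $\{|z|\ge R\}$ as $k\to\infty$. **Theorem.**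 Let $(a_k)\subset\mathbb C$ be a sequence with $\log^+|a_k|=o(n_k)$ as $k\to\infty$, where $\log^+ x=\max\{0,\log x\}$. If $(q_k)$ centers on $K$ and is $K$-regular, then $(q_k-a_k)$ centers on $K$ and is $K$-regular. Moreover, for every $k$ the root distribution of $q_k-a_k$ is the distribution of the value $a_k$ under $q_k$, $$\mu_{q_k-a_k}=\frac1{n_k}\sum_{z:\,q_k(z)=a_k} m_k(z)\,\delta_z,$$ where $m_k(z)$ is the multiplicity with which $q_k$ takes the value $a_k$ at $z$. -/

import Mathlib

open Filter Topology MeasureTheory Polynomial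
open scoped ENNReal NNReal

namespace KRegularFamilies

/-! ### Logarithmic potential theory in the plane -/

/-- Integral of an extended-real function: integral of the positive part minus integral of the
negative part. In all uses below (a logarithmic kernel or potential against a finite measure
with bounded support) the integral of the positive part is finite, so that the difference
is the usual value in `[-∞, ∞)`. -/
noncomputable def extIntegral {α : Type*} [MeasurableSpace α] (μ : Measure α) (f : α → EReal) :
    EReal :=
  ((∫⁻ x, (f x).toENNReal ∂μ : ℝ≥0∞) : EReal) - ((∫⁻ x, (-f x).toENNReal ∂μ : ℝ≥0∞) : EReal)

/-- The potential `p_μ(z) = ∫ log |z - w| dμ(w)`, with the convention `log 0 = -∞`. -/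
noncomputable def logPotential (μ : Measure ℂ) (z : ℂ) : EReal :=
  extIntegral μ fun w => ENNReal.log ‖z - w‖ₑ

/-- The energy `I(μ) = ∫∫ log |z - w| dμ(w) dμ(z) = ∫ p_μ dμ`. -/
noncomputable def logEnergy (μ : Measure ℂ) : EReal :=
  extIntegral μ (logPotential μ)

/-- A set is polar if `I(μ) = -∞` for every nonzero finite Borel measure `μ` carried by a compact
subset of it. -/
def IsPolar (E : Set ℂ) : Prop :=
  ∀ μ : Measure ℂ, IsFiniteMeasure μ → μ ≠ 0 →
    (∃ C : Set ℂ, IsCompact C ∧ C ⊆ E ∧ μ Cᶜ = 0) → logEnergy μ = ⊥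

/-- `ω` is an equilibrium measure of `K`: a Borel probability measure on `K` whose energy is
maximal among all Borel probability measures on `K`. -/
def IsEquilibriumMeasure (K : Set ℂ) (ω : Measure ℂ) : Prop :=
  IsProbabilityMeasure ω ∧ ω Kᶜ = 0 ∧
    ∀ μ : Measure ℂ, IsProbabilityMeasure μ → μ Kᶜ = 0 → logEnergy μ ≤ logEnergy ω

open Classical in
/-- The equilibrium measure of `K` (it exists and is unique for compact non-polar `K`). -/
noncomputable def equilibriumMeasure (K : Set ℂ) : Measure ℂ :=
  if h : ∃ ω, IsEquilibriumMeasure K ω then h.choose else 0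

/-- The Green's function `g_Ω = p_ω - I(ω)` with pole at `∞` of `Ω = ℂ \ K`, where `ω` is the
equilibrium measure of the compact non-polar set `K`. Both terms are finite on `Ω`, and only the
values on `Ω` are used. -/
noncomputable def greenFunction (K : Set ℂ) (z : ℂ) : ℝ :=
  (logPotential (equilibriumMeasure K) z - logEnergy (equilibriumMeasure K)).toReal

/-! ### Polynomial convexity -/

/-- The polynomially convex hull: all `z` with `|p(z)| ≤ sup_K |p|` for every polynomial `p`. -/
def polynomialHull (K : Set ℂ) : Set ℂ :=
  {z | ∀ (p : ℂ[X]) (c : ℝ), (∀ w ∈ K, ‖p.eval w‖ ≤ c) → ‖p.eval z‖ ≤ c}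

def IsPolynomiallyConvex (K : Set ℂ) : Prop := polynomialHull K = K

/-! ### Root and value distributions, centering, regularity -/

/-- The root distribution `μ_q = (1/n) ∑ δ_{z_j}` of a polynomial of degree `n > 0`, the roots
being repeated with multiplicity. -/
noncomputable def rootDistribution (q : ℂ[X]) : Measure ℂ :=
  (q.natDegree : ℝ≥0∞)⁻¹ • (q.roots.map Measure.dirac).sum

/-- The distribution of the value `a` under a polynomial `q` of degree `n > 0`:
`(1/n) ∑ m(z) δ_z` over all `z` with `q(z) = a`, where `m(z)` is the multiplicity with which `q`
takes the value `a` at `z`. -/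
noncomputable def valueDistribution (q : ℂ[X]) (a : ℂ) : Measure ℂ :=
  (q.natDegree : ℝ≥0∞)⁻¹ •
    ∑ᶠ z ∈ {z : ℂ | q.eval z = a}, ((q - C a).rootMultiplicity z : ℝ≥0∞) • Measure.dirac z

/-- The sequence `q` centers on `S`. -/
def CentersOn (q : ℕ → ℂ[X]) (S : Set ℂ) : Prop :=
  ∃ N : ℕ,
    (∃ R : ℝ, 0 < R ∧ ∀ k ≥ N, {z : ℂ | (q k).eval z = 0} ⊆ Metric.ball 0 R) ∧
    ∀ L : Set ℂ, IsClosed L → Disjoint L S →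
      ∃ M : ℝ≥0, 0 < M ∧ ∀ k ≥ N, ((q k).natDegree : ℝ≥0∞) * rootDistribution (q k) L ≤ M

/-- The sequence `q` is `K`-regular: for some `R > 0` with `K ⊆ 𝔻(0, R)`,
`(1/n_k) log |q_k| → g_Ω` uniformly on `ℂ \ 𝔻(0, R)`. The clause that `q_k` eventually has no zeros
there expresses that `log |q_k| = -∞` is excluded by the uniform convergence to the finite function
`g_Ω`. -/
def IsKRegular (K : Set ℂ) (q : ℕ → ℂ[X]) : Prop :=
  ∃ R : ℝ, 0 < R ∧ K ⊆ Metric.ball 0 R ∧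
    (∀ᶠ k in atTop, ∀ z ∈ (Metric.ball (0 : ℂ) R)ᶜ, (q k).eval z ≠ 0) ∧
    TendstoUniformlyOn
      (fun k z => 1 / ((q k).natDegree : ℝ) * Real.log ‖(q k).eval z‖)
      (greenFunction K) atTop (Metric.ball (0 : ℂ) R)ᶜ

end KRegularFamilies

open KRegularFamilies

namespace KRegularFamilies

/-! ### The complement of a polynomially convex set -/

/-! Write `n` for the degree of `q_k` and `g = p_ω - I` for the Green's function. Everything rests
on `g > 0` on `Ω`. Wherever `(1/n) log |q_k|` is close to `g`, the modulus `|q_k|` is exponentially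
large in `n`, hence at least `2|a_k|`, and there `log |q_k - a_k|` and `log |q_k|` differ by at most
`log 2`, which disappears after division by `n`.

Positivity: the equilibrium measure exists by weak compactness and lower semicontinuity of the
energy. Frostman's inequality gives `p_ω ≥ I` off `K`, and the minimum principle makes it strict,
because polynomial convexity makes `Ω` connected (`exists_greenFunction_eq`).

Regularity: on `{|z| ≥ R}` the function `g` is bounded below by some `δ > 0`, so the domination
holds there for large `k`. This gives both uniform convergence and a common disk for the zeros.

Centering is the harder half, since nearer to `K` there is no uniform convergence. By centering of
`q_k`, weak limits of the root distributions live on `K`; by regularity their potentials equal `p_ω`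
near `∞`, hence on all of `Ω` by analytic continuation. So the normalized average of `log |q_k|`
over a circle around `z`, whose disk misses `K`, tends to `g(z) > 0`
(`tendsto_inv_natDegree_mul_jensenSum`). As `q_k` has boundedly many roots in that disk, some
smaller concentric circles keep away from them, and `|q_k| ≥ 2|a_k|` there. Jensen's formula on two
such circles then bounds the number of roots of `q_k - a_k` inside in terms of that of `q_k`
(`exists_eventually_rootCount_sub_C_le`). Compactness turns these local bounds into centering. -/

theorem isPreconnected_setOf_lt_norm {R : ℝ} (hR : 0 < R) :
    IsPreconnected {z : ℂ | R < ‖z‖} := by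
  have h : {z : ℂ | R < ‖z‖} = Complex.exp '' {z : ℂ | Real.log R < z.re} := by
    ext z
    simp only [Set.mem_ofPred_eq, Set.mem_image]
    constructor
    · intro hz
      have hz0 : z ≠ 0 := norm_pos_iff.mp (hR.trans hz)
      refine ⟨Complex.log z, ?_, Complex.exp_log hz0⟩
      rw [Complex.log_re]
      exact Real.log_lt_log hR hz
    · rintro ⟨w, hw, rfl⟩
      rw [Complex.norm_exp]
      exact (Real.log_lt_iff_lt_exp hR).mp hw
  rw [h]
  exact (convex_halfSpace_re_gt _).isPreconnected.image _ Complex.continuous_exp.continuousOn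

/-- A bounded component of the complement has its boundary in `K`, so the maximum principle would
put it in the polynomial hull. Hence every component reaches the connected exterior of a large disk,
and there is only one. -/
theorem IsPolynomiallyConvex.isPreconnected_compl {K : Set ℂ} (hK : IsCompact K)
    (hc : IsPolynomiallyConvex K) : IsPreconnected Kᶜ := by
  obtain ⟨R, hR, hKR⟩ := hK.isBounded.subset_ball_lt 0 0
  have hE : {z : ℂ | R < ‖z‖} ⊆ Kᶜ := by
    intro z hz hzK
    have := hKR hzK
    rw [mem_ball_zero_iff] at this
    exact lt_asymm this hz
  have hpre := isPreconnected_setOf_lt_norm hR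
  have key : ∀ z ∈ Kᶜ, {z : ℂ | R < ‖z‖} ⊆ connectedComponentIn Kᶜ z := by
    intro z hz
    have hopen : IsOpen (connectedComponentIn Kᶜ z) :=
      hK.isClosed.isOpen_compl.connectedComponentIn
    have hzC := mem_connectedComponentIn hz
    obtain ⟨y, hyC, hyR⟩ : ∃ y ∈ connectedComponentIn Kᶜ z, R < ‖y‖ := by
      by_contra! hcon
      have hbd : Bornology.IsBounded (connectedComponentIn Kᶜ z) :=
        (Metric.isBounded_closedBall (x := (0 : ℂ)) (r := R)).subset fun y hy => by
          rw [mem_closedBall_zero_iff]; exact hcon y hy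
      -- A frontier point outside `K` would have an open component meeting this one, so it would lie
      -- in this component, which is open and so disjoint from its frontier.
      have hfr : frontier (connectedComponentIn Kᶜ z) ⊆ K := by
        intro x hx
        by_contra hxK
        rw [hopen.frontier_eq] at hx
        have hxo : IsOpen (connectedComponentIn Kᶜ x) :=
          hK.isClosed.isOpen_compl.connectedComponentIn
        obtain ⟨y, hy1, hy2⟩ := mem_closure_iff.mp hx.1 _ hxo (mem_connectedComponentIn hxK)
        have h1 := connectedComponentIn_eq hy1
        have h2 := connectedComponentIn_eq hy2
        exact hx.2 (h2.trans h1.symm ▸ mem_connectedComponentIn hxK)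
      have hzhull : z ∈ polynomialHull K := by
        intro p c hp
        refine Complex.norm_le_of_forall_mem_frontier_norm_le (f := fun z => p.eval z) hbd
          p.differentiable.diffContOnCl (fun w hw => hp w (hfr hw)) (subset_closure hzC)
      rw [hc] at hzhull
      exact hz hzhull
    have := hpre.subset_connectedComponentIn hyR hE
    rwa [← connectedComponentIn_eq hyC] at this
  have hz1 : ((R + 1 : ℝ) : ℂ) ∈ {z : ℂ | R < ‖z‖} := by
    simp only [Set.mem_ofPred_eq, Complex.norm_real, Real.norm_eq_abs]
    exact lt_of_lt_of_le (by linarith) (le_abs_self _)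
  refine isPreconnected_of_forall ((R + 1 : ℝ) : ℂ) fun z hz =>
    ⟨connectedComponentIn Kᶜ z, connectedComponentIn_subset _ _, key z hz hz1,
      mem_connectedComponentIn hz, isPreconnected_connectedComponentIn⟩

/-! ### Real-valued potentials off the support -/

/-- The potential of `μ` as a Bochner integral; meaningful off the support of `μ`. -/
noncomputable def realPotential (μ : Measure ℂ) (z : ℂ) : ℝ :=
  ∫ w, Real.log ‖z - w‖ ∂μ

theorem ae_mem_of_measure_compl_eq_zero {α : Type*} [MeasurableSpace α] {μ : Measure α}
    {K : Set α} (h : μ Kᶜ = 0) : ∀ᵐ w ∂μ, w ∈ K := h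

theorem integrable_of_continuousOn_of_compl_null {E : Type*} [NormedAddCommGroup E]
    {μ : Measure ℂ} [IsFiniteMeasure μ]
    {K : Set ℂ} (hK : IsCompact K) (hμ : μ Kᶜ = 0) {f : ℂ → E} (hf : ContinuousOn f K) :
    Integrable f μ := by
  have h := hf.integrableOn_compact (μ := μ) hK
  rwa [IntegrableOn, Measure.restrict_eq_self_of_ae_mem (ae_mem_of_measure_compl_eq_zero hμ)] at h

theorem integrable_log_norm_sub {μ : Measure ℂ} [IsFiniteMeasure μ]
    {K : Set ℂ} (hK : IsCompact K) (hμ : μ Kᶜ = 0) {z : ℂ} (hz : z ∉ K) :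
    Integrable (fun w => Real.log ‖z - w‖) μ := by
  refine integrable_of_continuousOn_of_compl_null hK hμ ?_
  refine ContinuousOn.log (by fun_prop) fun w hw => ?_
  rw [norm_ne_zero_iff, sub_ne_zero]
  rintro rfl
  exact hz hw

/-- Near `z₀` the potential is, up to a constant, the real part of the holomorphic function `∫ log
((z - w) / (z₀ - w)) dμ(w)`. Dividing by `z₀ - w` keeps the argument within distance `1` of `1`, so
the principal branch serves for all `w ∈ K` at once. -/
theorem harmonicOnNhd_realPotential {μ : Measure ℂ} [IsFiniteMeasure μ]
    {K : Set ℂ} (hK : IsCompact K) (hμ : μ Kᶜ = 0) :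
    InnerProductSpace.HarmonicOnNhd (realPotential μ) Kᶜ := by
  intro z₀ hz₀
  obtain ⟨r, hr, hball⟩ := Metric.isOpen_iff.mp hK.isClosed.isOpen_compl z₀ hz₀
  have hdist : ∀ w ∈ K, r ≤ ‖z₀ - w‖ := by
    intro w hw
    by_contra! h
    exact hball (show w ∈ Metric.ball z₀ r by rwa [mem_ball_iff_norm']) hw
  have hne : ∀ z ∈ Metric.ball z₀ (r / 2), ∀ w ∈ K, r / 2 ≤ ‖z - w‖ := by
    intro z hz w hw
    have h1 := hdist w hw
    rw [mem_ball_iff_norm'] at hz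
    have h2 : ‖z₀ - w‖ ≤ ‖z₀ - z‖ + ‖z - w‖ := norm_sub_le_norm_sub_add_norm_sub _ _ _
    linarith
  have hslit : ∀ z ∈ Metric.ball z₀ (r / 2), ∀ w ∈ K, (z - w) / (z₀ - w) ∈ Complex.slitPlane := by
    intro z hz w hw
    have h1 := hdist w hw
    have h0 : z₀ - w ≠ 0 := norm_pos_iff.mp (by linarith)
    have : (z - w) / (z₀ - w) = 1 + (z - z₀) / (z₀ - w) := by field_simp; ring
    rw [this]
    apply Complex.mem_slitPlane_of_norm_lt_one
    rw [norm_div, div_lt_one (by linarith)]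
    rw [mem_ball_iff_norm] at hz
    linarith
  have hint : ∀ z ∈ Metric.ball z₀ (r / 2),
      Integrable (fun w => Complex.log ((z - w) / (z₀ - w))) μ := by
    intro z hz
    refine integrable_of_continuousOn_of_compl_null hK hμ ?_
    refine ContinuousOn.clog (ContinuousOn.div (by fun_prop) (by fun_prop) fun w hw => ?_)
      fun w hw => hslit z hz w hw
    have h1 := hdist w hw
    exact norm_pos_iff.mp (by linarith)
  have hdiff : DifferentiableOn ℂ (fun z => ∫ w, Complex.log ((z - w) / (z₀ - w)) ∂μ)
      (Metric.ball z₀ (r / 2)) := by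
    intro z hz
    have hnhds := Metric.isOpen_ball.mem_nhds hz
    refine (hasDerivAt_integral_of_dominated_loc_of_deriv_le (𝕜 := ℂ)
      (F := fun z w => Complex.log ((z - w) / (z₀ - w))) (F' := fun z w => (z - w)⁻¹)
      (bound := fun _ => (r / 2)⁻¹) hnhds ?_ (hint z hz) ?_ ?_ (integrable_const _)
      ?_).2.differentiableAt.differentiableWithinAt
    · filter_upwards [hnhds] with x hx using (hint x hx).aestronglyMeasurable
    · exact Measurable.aestronglyMeasurable (by fun_prop)
    · filter_upwards [ae_mem_of_measure_compl_eq_zero hμ] with w hw x hx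
      rw [norm_inv]
      exact inv_anti₀ (by linarith) (hne x hx w hw)
    · filter_upwards [ae_mem_of_measure_compl_eq_zero hμ] with w hw x hx
      have h0 : z₀ - w ≠ 0 := norm_pos_iff.mp (by linarith [hdist w hw])
      have h1 : x - w ≠ 0 := norm_pos_iff.mp (by linarith [hne x hx w hw])
      have h2 : HasDerivAt (fun x => (x - w) / (z₀ - w)) (1 / (z₀ - w)) x :=
        ((hasDerivAt_id x).sub_const w).div_const _
      have h3 := h2.clog (hslit x hx w hw)
      have h4 : 1 / (z₀ - w) / ((x - w) / (z₀ - w)) = (x - w)⁻¹ := by field_simp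
      rwa [h4] at h3
  have hz₀' : z₀ ∈ Metric.ball z₀ (r / 2) := Metric.mem_ball_self (by linarith)
  have han := hdiff.analyticAt (Metric.isOpen_ball.mem_nhds hz₀')
  have hharm := han.harmonicAt_re.add
    (InnerProductSpace.harmonicAt_const (x := z₀) (realPotential μ z₀))
  refine (InnerProductSpace.harmonicAt_congr_nhds ?_).mp hharm
  filter_upwards [Metric.isOpen_ball.mem_nhds hz₀'] with z hz
  have hzK : z ∉ K := fun h => by
    have := hne z hz z h
    simp at this
    linarith
  have h1 : (∫ w, Complex.log ((z - w) / (z₀ - w)) ∂μ).re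
      = ∫ w, (Complex.log ((z - w) / (z₀ - w))).re ∂μ := by
    have := Complex.reCLM.integral_comp_comm (hint z hz)
    simpa using this.symm
  simp only [Pi.add_apply, h1, realPotential]
  have h2 : Integrable (fun w => (Complex.log ((z - w) / (z₀ - w))).re) μ := (hint z hz).re
  rw [← integral_add h2 (integrable_log_norm_sub hK hμ hz₀)]
  refine integral_congr_ae ?_
  filter_upwards [ae_mem_of_measure_compl_eq_zero hμ] with w hw
  have h3 : 0 < ‖z₀ - w‖ := by linarith [hdist w hw]
  have h4 : 0 < ‖z - w‖ := by linarith [hne z hz w hw]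
  rw [Complex.log_re, norm_div, Real.log_div h4.ne' h3.ne']
  ring

theorem realPotential_mem_Icc_log {μ : Measure ℂ} [IsProbabilityMeasure μ]
    {R : ℝ} (hμ : μ (Metric.closedBall 0 R)ᶜ = 0) {z : ℂ} (hz : R < ‖z‖) :
    realPotential μ z ∈ Set.Icc (Real.log (‖z‖ - R)) (Real.log (‖z‖ + R)) := by
  have hzK : z ∉ Metric.closedBall (0 : ℂ) R := by
    rw [mem_closedBall_zero_iff]; exact hz.not_ge
  have hint := integrable_log_norm_sub (isCompact_closedBall 0 R) hμ hzK
  have hae := ae_mem_of_measure_compl_eq_zero hμ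
  constructor
  · have h : ∫ _, Real.log (‖z‖ - R) ∂μ ≤ realPotential μ z := by
      refine integral_mono_ae (integrable_const _) hint ?_
      filter_upwards [hae] with w hw
      rw [mem_closedBall_zero_iff] at hw
      refine Real.log_le_log (by linarith) ?_
      linarith [norm_sub_norm_le z w]
    simpa using h
  · have h : realPotential μ z ≤ ∫ _, Real.log (‖z‖ + R) ∂μ := by
      refine integral_mono_ae hint (integrable_const _) ?_
      filter_upwards [hae] with w hw
      rw [mem_closedBall_zero_iff] at hw
      refine Real.log_le_log ?_ ?_
      · linarith [norm_sub_norm_le z w]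
      · linarith [norm_sub_le z w]
    simpa using h

theorem tendsto_log_norm_add_sub_log_norm (c : ℝ) :
    Tendsto (fun z : ℂ => Real.log (‖z‖ + c) - Real.log ‖z‖) (Bornology.cobounded ℂ) (𝓝 0) := by
  have h1 : Tendsto (fun z : ℂ => Real.log (1 + c / ‖z‖)) (Bornology.cobounded ℂ) (𝓝 0) := by
    have h2 : Tendsto (fun z : ℂ => 1 + c / ‖z‖) (Bornology.cobounded ℂ) (𝓝 (1 + 0)) :=
      tendsto_const_nhds.add (tendsto_const_nhds.div_atTop tendsto_norm_cobounded_atTop)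
    rw [add_zero] at h2
    have h3 := h2.log one_ne_zero
    rwa [Real.log_one] at h3
  refine h1.congr' ?_
  filter_upwards [tendsto_norm_cobounded_atTop.eventually_gt_atTop (max 0 (-c))] with z hz
  have h0 : 0 < ‖z‖ := (le_max_left _ _).trans_lt hz
  have h4 : 0 < ‖z‖ + c := by linarith [(le_max_right 0 (-c)).trans_lt hz]
  rw [← Real.log_div h4.ne' h0.ne', add_div, div_self h0.ne']

theorem tendsto_realPotential_sub_log_norm {μ : Measure ℂ} [IsProbabilityMeasure μ]
    {K : Set ℂ} (hK : IsCompact K) (hμ : μ Kᶜ = 0) :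
    Tendsto (fun z => realPotential μ z - Real.log ‖z‖) (Bornology.cobounded ℂ) (𝓝 0) := by
  obtain ⟨R, hR, hKR⟩ := hK.isBounded.subset_closedBall_lt 0 0
  have hμ' : μ (Metric.closedBall 0 R)ᶜ = 0 :=
    measure_mono_null (Set.compl_subset_compl.mpr hKR) hμ
  have h1 := tendsto_log_norm_add_sub_log_norm (-R)
  have h2 := tendsto_log_norm_add_sub_log_norm R
  refine tendsto_of_tendsto_of_tendsto_of_le_of_le' h1 h2 ?_ ?_ <;>
  · filter_upwards [tendsto_norm_cobounded_atTop.eventually_gt_atTop R] with z hz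
    have h := realPotential_mem_Icc_log hμ' hz
    have h3 := h.1
    have h4 := h.2
    rw [sub_eq_add_neg] at h3
    linarith

theorem tendsto_realPotential_atTop {μ : Measure ℂ} [IsProbabilityMeasure μ]
    {K : Set ℂ} (hK : IsCompact K) (hμ : μ Kᶜ = 0) :
    Tendsto (realPotential μ) (Bornology.cobounded ℂ) atTop := by
  have h1 : Tendsto (fun z : ℂ => Real.log ‖z‖) (Bornology.cobounded ℂ) atTop :=
    Real.tendsto_log_atTop.comp tendsto_norm_cobounded_atTop
  refine ((tendsto_realPotential_sub_log_norm hK hμ).add_atTop h1).congr fun z => by ring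

/-- A harmonic function attaining a minimum at the center of a ball is constant on the ball. -/
theorem eqOn_ball_of_harmonicOnNhd_of_le {f : ℂ → ℝ} {z₀ : ℂ} {r : ℝ}
    (hf : InnerProductSpace.HarmonicOnNhd f (Metric.ball z₀ r))
    (hmin : ∀ z ∈ Metric.ball z₀ r, f z₀ ≤ f z) : ∀ z ∈ Metric.ball z₀ r, f z = f z₀ := by
  intro z hz
  have hz₀ : z₀ ∈ Metric.ball z₀ r := Metric.mem_ball_self (Metric.pos_of_mem_ball hz)
  obtain ⟨F, hF, hFf⟩ := hf.exists_analyticOnNhd_ball_re_eq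
  have hre : ∀ w ∈ Metric.ball z₀ r, ‖Complex.exp (-F w)‖ = Real.exp (-f w) := by
    intro w hw
    rw [Complex.norm_exp, Complex.neg_re, ← hFf hw]
  -- With `f = Re F`, a minimum of `f` is a maximum of `|exp (-F)|`, so the maximum modulus
  -- principle applies.
  have h := Complex.norm_eqOn_of_isPreconnected_of_isMaxOn (f := fun w => Complex.exp (-F w))
    (convex_ball z₀ r).isPreconnected Metric.isOpen_ball
    (hF.differentiableOn.neg.cexp) hz₀ (fun w hw => by
      simp only [Set.mem_ofPred_eq, Function.comp_apply]
      rw [hre w hw, hre z₀ hz₀]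
      exact Real.exp_le_exp.mpr (neg_le_neg (hmin w hw))) hz
  simp only [Function.comp_apply, Function.const_apply] at h
  rw [hre z hz, hre z₀ hz₀] at h
  exact neg_injective (Real.exp_injective h)

/-- The strong minimum principle for harmonic functions. -/
theorem eqOn_of_harmonicOnNhd_of_le {f : ℂ → ℝ} {U : Set ℂ} (hU : IsOpen U)
    (hconn : IsPreconnected U) (hf : InnerProductSpace.HarmonicOnNhd f U) {z₀ : ℂ} (hz₀ : z₀ ∈ U)
    (hmin : ∀ z ∈ U, f z₀ ≤ f z) : Set.EqOn f (fun _ => f z₀) U := by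
  obtain ⟨r, hr, hball⟩ := Metric.isOpen_iff.mp hU z₀ hz₀
  have h := eqOn_ball_of_harmonicOnNhd_of_le (hf.mono hball) fun z hz => hmin z (hball hz)
  refine AnalyticOnNhd.eqOn_of_preconnected_of_eventuallyEq (𝕜 := ℝ)
    (fun z hz => HarmonicAt.analyticAt (hf z hz)) analyticOnNhd_const hconn hz₀ ?_
  filter_upwards [Metric.ball_mem_nhds z₀ hr] with z hz using h z hz

/-- Two potentials of measures on `K` that agree near one point of a connected complement agree
on all of it. -/
theorem realPotential_eqOn_compl {μ ν : Measure ℂ} [IsFiniteMeasure μ] [IsFiniteMeasure ν]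
    {K : Set ℂ} (hK : IsCompact K) (hconn : IsPreconnected Kᶜ) (hμ : μ Kᶜ = 0) (hν : ν Kᶜ = 0)
    {z₀ : ℂ} (hz₀ : z₀ ∈ Kᶜ) (h : realPotential μ =ᶠ[𝓝 z₀] realPotential ν) :
    Set.EqOn (realPotential μ) (realPotential ν) Kᶜ :=
  AnalyticOnNhd.eqOn_of_preconnected_of_eventuallyEq (𝕜 := ℝ)
    (fun z hz => HarmonicAt.analyticAt (harmonicOnNhd_realPotential hK hμ z hz))
    (fun z hz => HarmonicAt.analyticAt (harmonicOnNhd_realPotential hK hν z hz)) hconn hz₀ h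

/-! ### The logarithmic kernel with values in `[0, ∞]` -/

/-- Moves a function bounded above into `[0, ∞]`, where Tonelli, Fatou and monotone convergence need
no integrability. It follows by integrating the pointwise identity `(c - f)⁺ + f⁺ = c + f⁻`. -/
theorem extIntegral_eq_sub_lintegral {α : Type*} [MeasurableSpace α] {μ : Measure α}
    [IsFiniteMeasure μ] {f : α → EReal} (hf : AEMeasurable f μ) {c : ℝ} (hc : 0 ≤ c)
    (hfc : ∀ᵐ x ∂μ, f x ≤ c) :
    extIntegral μ f = ((ENNReal.ofReal c * μ Set.univ : ℝ≥0∞) : EReal) -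
      ((∫⁻ x, ((c : EReal) - f x).toENNReal ∂μ : ℝ≥0∞) : EReal) := by
  have hpt : ∀ᵐ x ∂μ, ((c : EReal) - f x).toENNReal + (f x).toENNReal
      = ENNReal.ofReal c + (-f x).toENNReal := by
    filter_upwards [hfc] with x hx
    induction hfx : f x with
    | bot => simp
    | top => rw [hfx] at hx; simp at hx
    | coe y =>
      rw [hfx] at hx
      have hx' : y ≤ c := by exact_mod_cast hx
      rw [← EReal.coe_sub, ← EReal.coe_neg, EReal.real_coe_toENNReal, EReal.real_coe_toENNReal,
        EReal.real_coe_toENNReal]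
      rcases le_total 0 y with h | h
      · rw [ENNReal.ofReal_of_nonpos (neg_nonpos.mpr h), ← ENNReal.ofReal_add (by linarith) h]
        simp
      · rw [ENNReal.ofReal_of_nonpos h, ← ENNReal.ofReal_add hc (by linarith), add_zero,
          sub_eq_add_neg]
  have hsum := lintegral_congr_ae hpt
  have hcsum : AEMeasurable (fun x => (f x).toENNReal) μ := hf.ereal_toENNReal
  rw [lintegral_add_right' _ hcsum, lintegral_add_left measurable_const, lintegral_const] at hsum
  have hfin : ∫⁻ x, (f x).toENNReal ∂μ ≠ ∞ := by
    refine ne_top_of_le_ne_top (b := ENNReal.ofReal c * μ Set.univ) (by finiteness) ?_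
    rw [← lintegral_const]
    refine lintegral_mono_ae ?_
    filter_upwards [hfc] with x hx
    simpa using EReal.toENNReal_le_toENNReal hx
  unfold extIntegral
  have hm : ENNReal.ofReal c * μ Set.univ ≠ ∞ := by finiteness
  generalize ENNReal.ofReal c * μ Set.univ = m at *
  generalize ∫⁻ x, (f x).toENNReal ∂μ = A at *
  generalize ∫⁻ x, (-f x).toENNReal ∂μ = B at *
  generalize ∫⁻ x, ((c : EReal) - f x).toENNReal ∂μ = N at *
  lift A to ℝ≥0 using hfin
  lift m to ℝ≥0 using hm
  by_cases hN : N = ∞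
  · subst hN
    have hB : B = ∞ := by
      by_contra hB
      lift B to ℝ≥0 using hB
      simp only [top_add] at hsum
      exact absurd hsum.symm (by finiteness)
    subst hB
    simp [EReal.sub_top]
  · have hB : B ≠ ∞ := by
      rintro rfl
      lift N to ℝ≥0 using hN
      simp only [add_top] at hsum
      exact absurd hsum (by finiteness)
    lift N to ℝ≥0 using hN
    lift B to ℝ≥0 using hB
    have h2 : (N : ℝ) + A = m + B := by exact_mod_cast hsum
    rw [EReal.coe_nnreal_eq_coe_real, EReal.coe_nnreal_eq_coe_real, EReal.coe_nnreal_eq_coe_real,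
      EReal.coe_nnreal_eq_coe_real]
    have h3 : (A : ℝ) - B = m - N := by linarith
    exact_mod_cast h3

/-- The kernel `c - log |z - w|`, truncated below at zero. -/
noncomputable def logKernel (c : ℝ) (z w : ℂ) : ℝ≥0∞ :=
  ((c : EReal) - ENNReal.log ‖z - w‖ₑ).toENNReal

theorem continuous_logKernel (c : ℝ) : Continuous fun p : ℂ × ℂ => logKernel c p.1 p.2 := by
  unfold logKernel
  refine Continuous.ereal_toENNReal ?_
  have h1 : Continuous fun p : ℂ × ℂ => -ENNReal.log ‖p.1 - p.2‖ₑ := by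
    exact continuous_neg.comp (ENNReal.continuous_log.comp (by fun_prop))
  have h2 : Continuous fun x : EReal => (c : EReal) + x := by
    rw [continuous_iff_continuousAt]
    intro x
    exact (EReal.continuousAt_add (p := ((c : EReal), x)) (by simp) (by simp)).comp
      (f := fun x : EReal => ((c : EReal), x)) (by fun_prop)
  exact h2.comp h1

theorem logKernel_comm (c : ℝ) (z w : ℂ) : logKernel c z w = logKernel c w z := by
  rw [logKernel, logKernel, ← enorm_neg, neg_sub]

theorem log_enorm_sub {z w : ℂ} (h : z ≠ w) :
    ENNReal.log ‖z - w‖ₑ = (Real.log ‖z - w‖ : ℝ) := by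
  rw [← ofReal_norm, ENNReal.log_ofReal_of_pos (norm_pos_iff.mpr (sub_ne_zero.mpr h))]

theorem logKernel_of_ne (c : ℝ) {z w : ℂ} (h : z ≠ w) :
    logKernel c z w = ENNReal.ofReal (c - Real.log ‖z - w‖) := by
  rw [logKernel, log_enorm_sub h, ← EReal.coe_sub, EReal.real_coe_toENNReal]

theorem logKernel_self (c : ℝ) (z : ℂ) : logKernel c z z = ∞ := by
  simp [logKernel]

theorem log_enorm_sub_le {z w : ℂ} {c : ℝ} (h : ‖z - w‖ ≤ Real.exp c) :
    ENNReal.log ‖z - w‖ₑ ≤ c := by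
  rcases eq_or_ne z w with rfl | hne
  · simp
  · rw [log_enorm_sub hne, EReal.coe_le_coe_iff]
    exact (Real.log_le_iff_le_exp (norm_pos_iff.mpr (sub_ne_zero.mpr hne))).mpr h

/-- The potential of `μ` for the kernel `logKernel`. -/
noncomputable def kernelPotential (c : ℝ) (μ : Measure ℂ) (z : ℂ) : ℝ≥0∞ :=
  ∫⁻ w, logKernel c z w ∂μ

/-- The mutual energy of two measures for the kernel `logKernel`. -/
noncomputable def kernelEnergy (c : ℝ) (μ ν : Measure ℂ) : ℝ≥0∞ :=
  ∫⁻ z, kernelPotential c ν z ∂μ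

theorem measurable_logKernel (c : ℝ) (z : ℂ) : Measurable (logKernel c z) :=
  ((continuous_logKernel c).comp (Continuous.prodMk_right z)).measurable

theorem measurable_kernelPotential (c : ℝ) (μ : Measure ℂ) [SFinite μ] :
    Measurable (kernelPotential c μ) :=
  (continuous_logKernel c).measurable.lintegral_prod_right'

theorem kernelEnergy_comm (c : ℝ) (μ ν : Measure ℂ) [SFinite μ] [SFinite ν] :
    kernelEnergy c μ ν = kernelEnergy c ν μ := by
  unfold kernelEnergy kernelPotential
  rw [lintegral_lintegral_swap (continuous_logKernel c).measurable.aemeasurable]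
  simp_rw [logKernel_comm c]

theorem logPotential_eq_sub_kernelPotential {μ : Measure ℂ} [IsFiniteMeasure μ] {K : Set ℂ}
    (hμ : μ Kᶜ = 0) {c : ℝ} (hc : 0 ≤ c) {z : ℂ} (hz : ∀ w ∈ K, ‖z - w‖ ≤ Real.exp c) :
    logPotential μ z = ((c * μ.real Set.univ : ℝ) : EReal) - (kernelPotential c μ z : EReal) := by
  unfold logPotential kernelPotential
  rw [extIntegral_eq_sub_lintegral (c := c) _ hc]
  · rw [← ENNReal.ofReal_toReal (measure_ne_top μ Set.univ), ← ENNReal.ofReal_mul hc,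
      EReal.coe_ennreal_ofReal, max_eq_left (by positivity)]
    rfl
  · filter_upwards [ae_mem_of_measure_compl_eq_zero hμ] with w hw
    exact log_enorm_sub_le (hz w hw)
  · exact (ENNReal.measurable_log.comp (by fun_prop)).aemeasurable

/-- Once `exp c` is at least the diameter of `K`, the truncation in `logKernel` is never active on
`K × K`. Maximizing the logarithmic energy over probability measures on `K` is then minimizing
`kernelEnergy`. -/
theorem logEnergy_eq_sub_kernelEnergy {μ : Measure ℂ} [IsFiniteMeasure μ] {K : Set ℂ}
    (hμ : μ Kᶜ = 0) {c : ℝ} (hc : 0 ≤ c) (hz : ∀ z ∈ K, ∀ w ∈ K, ‖z - w‖ ≤ Real.exp c) :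
    logEnergy μ = ((c * μ.real Set.univ ^ 2 : ℝ) : EReal) - (kernelEnergy c μ μ : EReal) := by
  have hc' : 0 ≤ c * μ.real Set.univ := by positivity
  have hae : logPotential μ =ᵐ[μ]
      fun z => ((c * μ.real Set.univ : ℝ) : EReal) - (kernelPotential c μ z : EReal) := by
    filter_upwards [ae_mem_of_measure_compl_eq_zero hμ] with z hzK
    exact logPotential_eq_sub_kernelPotential hμ hc (hz z hzK)
  unfold logEnergy kernelEnergy
  rw [extIntegral_eq_sub_lintegral (c := c * μ.real Set.univ) _ hc']
  · have h : ∫⁻ z, (((c * μ.real Set.univ : ℝ) : EReal) - logPotential μ z).toENNReal ∂μ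
        = ∫⁻ z, kernelPotential c μ z ∂μ := by
      refine lintegral_congr_ae ?_
      filter_upwards [hae] with z hz
      rw [hz]
      generalize c * μ.real Set.univ = d
      induction hU : kernelPotential c μ z with
      | top => simp
      | coe x =>
        rw [EReal.coe_nnreal_eq_coe_real, ← EReal.coe_sub, ← EReal.coe_sub,
          EReal.real_coe_toENNReal]
        simp
    rw [h, ← ENNReal.ofReal_toReal (measure_ne_top μ Set.univ), ← ENNReal.ofReal_mul hc',
      EReal.coe_ennreal_ofReal, max_eq_left (by positivity), pow_two, ← mul_assoc]
    rfl
  · filter_upwards [hae] with z hz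
    rw [hz]
    exact EReal.sub_le_of_le_add (le_add_of_nonneg_right (EReal.coe_ennreal_nonneg _))
  · refine AEMeasurable.congr ?_ hae.symm
    exact (measurable_const.sub (measurable_kernelPotential c μ).coe_ereal_ennreal).aemeasurable

/-! ### Minimizers of the kernel energy -/

theorem kernelEnergy_add_left (c : ℝ) (μ ν τ : Measure ℂ) :
    kernelEnergy c (μ + ν) τ = kernelEnergy c μ τ + kernelEnergy c ν τ :=
  lintegral_add_measure _ _ _

theorem kernelEnergy_smul_left (c : ℝ) (a : ℝ≥0∞) (μ τ : Measure ℂ) :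
    kernelEnergy c (a • μ) τ = a * kernelEnergy c μ τ :=
  lintegral_smul_measure _ _

theorem kernelEnergy_add_right (c : ℝ) (μ ν τ : Measure ℂ) [SFinite μ] [SFinite ν] [SFinite τ] :
    kernelEnergy c τ (μ + ν) = kernelEnergy c τ μ + kernelEnergy c τ ν := by
  rw [kernelEnergy_comm, kernelEnergy_add_left, kernelEnergy_comm c τ, kernelEnergy_comm c τ]

theorem kernelEnergy_smul_right (c : ℝ) (a : ℝ≥0∞) (μ τ : Measure ℂ) [SFinite μ] [SFinite τ] :
    kernelEnergy c τ (a • μ) = a * kernelEnergy c τ μ := by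
  rw [kernelEnergy_comm, kernelEnergy_smul_left, kernelEnergy_comm c τ]

theorem kernelEnergy_mono {c : ℝ} {μ μ' ν ν' : Measure ℂ} (h : μ ≤ μ') (h' : ν ≤ ν') :
    kernelEnergy c μ ν ≤ kernelEnergy c μ' ν' :=
  lintegral_mono' h fun _ => lintegral_mono' h' le_rfl

/-- Fatou's lemma along a sequence converging to `z`; the kernel is continuous into `[0, ∞]`,
including on the diagonal. -/
theorem lowerSemicontinuous_kernelPotential (c : ℝ) (μ : Measure ℂ) :
    LowerSemicontinuous (kernelPotential c μ) := by
  intro z s hs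
  by_contra hcon
  obtain ⟨u, hu, hus⟩ := exists_seq_forall_of_frequently (not_eventually.mp hcon)
  have h1 : kernelPotential c μ z = ∫⁻ w, liminf (fun n => logKernel c (u n) w) atTop ∂μ := by
    refine lintegral_congr fun w => (Tendsto.liminf_eq ?_).symm
    exact (((continuous_logKernel c).comp (Continuous.prodMk_left w)).tendsto z).comp hu
  have h2 : kernelPotential c μ z ≤ liminf (fun n => kernelPotential c μ (u n)) atTop :=
    h1 ▸ lintegral_liminf_le fun n => measurable_logKernel c (u n)
  have h3 : liminf (fun n => kernelPotential c μ (u n)) atTop ≤ s :=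
    liminf_le_of_frequently_le' (Frequently.of_forall fun n => not_lt.mp (hus n))
  exact absurd (h2.trans h3) (not_le.mpr hs)

/-- If `ω` minimizes the kernel energy among probability measures on `K`, no part of `ω` can have
average potential above the energy. -/
theorem setLIntegral_kernelPotential_le {K : Set ℂ} {c : ℝ} {ω : Measure ℂ}
    [IsProbabilityMeasure ω] (hω : ω Kᶜ = 0) (hfin : kernelEnergy c ω ω ≠ ∞)
    (hmin : ∀ μ : Measure ℂ, IsProbabilityMeasure μ → μ Kᶜ = 0 →
      kernelEnergy c ω ω ≤ kernelEnergy c μ μ) {B : Set ℂ} (hB : MeasurableSet B) :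
    ∫⁻ z in B, kernelPotential c ω z ∂ω ≤ kernelEnergy c ω ω * ω B := by
  set τ := ω.restrict B with hτ
  have hτω : τ ≤ ω := Measure.restrict_le_self
  have hF : kernelEnergy c τ τ ≠ ∞ := ne_top_of_le_ne_top hfin (kernelEnergy_mono hτω hτω)
  have hE : kernelEnergy c τ ω ≠ ∞ := ne_top_of_le_ne_top hfin (kernelEnergy_mono hτω le_rfl)
  change kernelEnergy c τ ω ≤ _
  have hβ : ω B ≠ ∞ := measure_ne_top _ _
  set j := (kernelEnergy c ω ω).toReal with hj
  set E := (kernelEnergy c τ ω).toReal with hEdef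
  set F := (kernelEnergy c τ τ).toReal with hFdef
  set β := (ω B).toReal with hβdef
  have hβ0 : 0 ≤ β := ENNReal.toReal_nonneg
  -- the perturbed measure
  have main : ∀ t : ℝ, 0 < t → t ≤ 1 →
      0 ≤ 2 * β * j - 2 * E + t * (β ^ 2 * j - 2 * β * E + F) := by
    intro t ht ht1
    have ha : 0 ≤ 1 + t * β - t := by nlinarith
    have ha' : 0 ≤ 1 + t * β := by positivity
    -- This is `(1 + tβ) ω - t τ`, which removes a little of the mass on `B` and renormalizes.
    -- Splitting over `B` and `Bᶜ` avoids subtracting measures; the coefficients are nonnegative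
    -- because `t ≤ 1`.
    obtain ⟨μ, hμ⟩ : ∃ μ : Measure ℂ, μ =
      ENNReal.ofReal (1 + t * β) • ω.restrict Bᶜ + ENNReal.ofReal (1 + t * β - t) • τ := ⟨_, rfl⟩
    have hsum : μ + ENNReal.ofReal t • τ = ENNReal.ofReal (1 + t * β) • ω := by
      rw [hμ, add_assoc, ← add_smul, ← ENNReal.ofReal_add ha ht.le, sub_add_cancel, ← smul_add,
        hτ, Measure.restrict_compl_add_restrict hB]
    have hμfin : IsFiniteMeasure μ := by
      rw [hμ]
      constructor
      simp only [Measure.add_apply, Measure.smul_apply, smul_eq_mul]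
      finiteness
    have hprob : IsProbabilityMeasure μ := by
      constructor
      have h1 := congrArg (fun m : Measure ℂ => m Set.univ) hsum
      simp only [Measure.add_apply, Measure.smul_apply, smul_eq_mul, measure_univ, mul_one, hτ,
        Measure.restrict_apply_univ] at h1
      rw [← ENNReal.ofReal_toReal hβ, ← hβdef, ← ENNReal.ofReal_mul ht.le,
        ENNReal.ofReal_add zero_le_one (by positivity), ENNReal.ofReal_one] at h1
      exact (ENNReal.add_left_inj ENNReal.ofReal_ne_top).mp h1
    have hμK : μ Kᶜ = 0 := by
      have h1 : μ ≤ ENNReal.ofReal (1 + t * β) • ω := by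
        rw [← hsum]; exact Measure.le_add_right le_rfl
      refine le_antisymm ((h1 _).trans ?_) bot_le
      simp [hω]
    have hle := hmin μ hprob hμK
    have hX : kernelEnergy c τ μ ≠ ∞ ∧
        (1 + t * β) * E = (kernelEnergy c τ μ).toReal + t * F := by
      have h1 : kernelEnergy c τ (μ + ENNReal.ofReal t • τ)
          = kernelEnergy c τ (ENNReal.ofReal (1 + t * β) • ω) := by rw [hsum]
      rw [kernelEnergy_add_right, kernelEnergy_smul_right, kernelEnergy_smul_right] at h1
      have hne : kernelEnergy c τ μ ≠ ∞ := by
        refine ne_top_of_le_ne_top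
          (ENNReal.mul_ne_top (ENNReal.ofReal_ne_top (r := 1 + t * β)) hE) ?_
        rw [← h1]
        exact le_self_add
      refine ⟨hne, ?_⟩
      have h2 := congrArg ENNReal.toReal h1
      rw [ENNReal.toReal_add hne (by finiteness), ENNReal.toReal_mul, ENNReal.toReal_mul,
        ENNReal.toReal_ofReal ha', ENNReal.toReal_ofReal ht.le] at h2
      exact h2.symm
    have hJ : (1 + t * β) ^ 2 * j = (kernelEnergy c μ μ).toReal
        + 2 * t * (kernelEnergy c τ μ).toReal + t ^ 2 * F ∧ kernelEnergy c μ μ ≠ ∞ := by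
      have h1 : kernelEnergy c (μ + ENNReal.ofReal t • τ) (μ + ENNReal.ofReal t • τ)
          = kernelEnergy c (ENNReal.ofReal (1 + t * β) • ω) (ENNReal.ofReal (1 + t * β) • ω) := by
        rw [hsum]
      rw [kernelEnergy_add_right, kernelEnergy_add_left c _ _ μ,
        kernelEnergy_add_left c _ _ (_ • τ),
        kernelEnergy_smul_right, kernelEnergy_smul_right, kernelEnergy_smul_right,
        kernelEnergy_smul_left, kernelEnergy_smul_left, kernelEnergy_smul_left,
        kernelEnergy_comm c μ τ] at h1
      have hne : kernelEnergy c μ μ ≠ ∞ := by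
        refine ne_top_of_le_ne_top (ENNReal.mul_ne_top (ENNReal.ofReal_ne_top (r := 1 + t * β))
          (ENNReal.mul_ne_top (ENNReal.ofReal_ne_top (r := 1 + t * β)) hfin)) ?_
        rw [← h1, add_assoc]
        exact le_self_add
      refine ⟨?_, hne⟩
      have hX1 := hX.1
      have h2 := congrArg ENNReal.toReal h1
      rw [ENNReal.toReal_add (by finiteness) (by finiteness),
        ENNReal.toReal_add (by finiteness) (by finiteness),
        ENNReal.toReal_add (by finiteness) (by finiteness)] at h2
      simp only [ENNReal.toReal_mul, ENNReal.toReal_ofReal ha', ENNReal.toReal_ofReal ht.le] at h2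
      rw [← hFdef, ← hj] at h2
      linarith
    have hle' : j ≤ (kernelEnergy c μ μ).toReal := (ENNReal.toReal_le_toReal hfin hJ.2).mpr hle
    have h3 := hX.2
    have h4 := hJ.1
    -- The energy of `μ` is `(1 + tβ)² j - 2t(1 + tβ) E + t² F`, and it is at least `j`. Dividing by
    -- `t` and letting `t → 0` leaves `E ≤ β j`.
    have h5 : 0 ≤ t * (2 * β * j - 2 * E + t * (β ^ 2 * j - 2 * β * E + F)) := by nlinarith
    exact nonneg_of_mul_nonneg_right h5 ht
  have hlim : Tendsto (fun t : ℝ => 2 * β * j - 2 * E + t * (β ^ 2 * j - 2 * β * E + F))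
      (𝓝[>] 0) (𝓝 (2 * β * j - 2 * E + 0 * (β ^ 2 * j - 2 * β * E + F))) :=
    (Continuous.tendsto (by fun_prop) 0).mono_left nhdsWithin_le_nhds
  have h0 : 0 ≤ 2 * β * j - 2 * E + 0 * (β ^ 2 * j - 2 * β * E + F) := by
    refine ge_of_tendsto hlim ?_
    filter_upwards [Ioc_mem_nhdsGT (zero_lt_one' ℝ)] with t ht using main t ht.1 ht.2
  rw [← ENNReal.toReal_le_toReal hE (by finiteness), ENNReal.toReal_mul]
  linarith

/-- If the potential exceeded the energy at a support point, lower semicontinuity would give an open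
neighbourhood of positive mass on which it stays above some `s` larger than the energy,
contradicting the bound on averages. -/
theorem kernelPotential_le_of_mem_support {K : Set ℂ} {c : ℝ} {ω : Measure ℂ}
    [IsProbabilityMeasure ω] (hω : ω Kᶜ = 0) (hfin : kernelEnergy c ω ω ≠ ∞)
    (hmin : ∀ μ : Measure ℂ, IsProbabilityMeasure μ → μ Kᶜ = 0 →
      kernelEnergy c ω ω ≤ kernelEnergy c μ μ) {ζ : ℂ} (hζ : ζ ∈ ω.support) :
    kernelPotential c ω ζ ≤ kernelEnergy c ω ω := by
  by_contra! hlt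
  obtain ⟨s, hs1, hs2⟩ := exists_between hlt
  have hopen := (lowerSemicontinuous_kernelPotential c ω).isOpen_preimage s
  set B := kernelPotential c ω ⁻¹' Set.Ioi s with hB
  have hpos : 0 < ω B := (Measure.mem_support_iff_forall ζ).mp hζ B (hopen.mem_nhds hs2)
  have h1 := setLIntegral_kernelPotential_le hω hfin hmin hopen.measurableSet
  have h2 : s * ω B ≤ ∫⁻ z in B, kernelPotential c ω z ∂ω := by
    rw [← setLIntegral_const]
    exact setLIntegral_mono (measurable_kernelPotential c ω) fun z hz => le_of_lt hz
  have h3 : kernelEnergy c ω ω * ω B < s * ω B :=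
    (ENNReal.mul_lt_mul_iff_left hpos.ne' (measure_ne_top _ _)).mpr hs1
  exact absurd (h2.trans h1) h3.not_ge

/-! ### The continuity principle and Frostman's inequality -/

theorem kernelPotential_eq_ofReal {μ : Measure ℂ} [IsProbabilityMeasure μ] {K : Set ℂ}
    (hK : IsCompact K) (hμ : μ Kᶜ = 0) {c : ℝ} {z : ℂ} (hzK : z ∉ K)
    (hz : ∀ w ∈ K, ‖z - w‖ ≤ Real.exp c) :
    kernelPotential c μ z = ENNReal.ofReal (c - realPotential μ z) := by
  have hint := integrable_log_norm_sub hK hμ hzK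
  have h1 : c - realPotential μ z = ∫ w, (c - Real.log ‖z - w‖) ∂μ := by
    rw [integral_sub (integrable_const _) hint]
    simp [realPotential]
  have hne : ∀ w ∈ K, z ≠ w := by rintro w hw rfl; exact hzK hw
  have hint' : Integrable (fun w => c - Real.log ‖z - w‖) μ := (integrable_const _).sub hint
  rw [h1, ofReal_integral_eq_lintegral_ofReal hint']
  · refine lintegral_congr_ae ?_
    filter_upwards [ae_mem_of_measure_compl_eq_zero hμ] with w hw
    exact logKernel_of_ne c (hne w hw)
  · filter_upwards [ae_mem_of_measure_compl_eq_zero hμ] with w hw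
    have h2 := log_enorm_sub_le (hz w hw)
    rw [log_enorm_sub (hne w hw), EReal.coe_le_coe_iff] at h2
    exact sub_nonneg.mpr h2

/-- If `z'` is at least as near to `z` as every point of `S`, then `|z' - w| ≤ 2 |z - w|` for `w ∈
S`. Replacing `z` by its nearest point in the support thus costs only `log 2`. -/
theorem logKernel_le_add_log_two (c : ℝ) {S : Set ℂ} {z z' w : ℂ}
    (hz' : ∀ w ∈ S, ‖z - z'‖ ≤ ‖z - w‖) (hw : w ∈ S) :
    logKernel c z w ≤ logKernel c z' w + ENNReal.ofReal (Real.log 2) := by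
  have hle := hz' w hw
  rcases eq_or_ne z' w with rfl | h1
  · simp [logKernel_self]
  have h2 : z ≠ w := by
    rintro rfl
    rw [sub_self, norm_zero, norm_le_zero_iff, sub_eq_zero] at hle
    exact h1 hle.symm
  have p1 : 0 < ‖z' - w‖ := norm_pos_iff.mpr (sub_ne_zero.mpr h1)
  have p2 : 0 < ‖z - w‖ := norm_pos_iff.mpr (sub_ne_zero.mpr h2)
  rw [logKernel_of_ne c h1, logKernel_of_ne c h2]
  refine le_trans (ENNReal.ofReal_le_ofReal ?_) ENNReal.ofReal_add_le
  have h3 : ‖z' - w‖ ≤ 2 * ‖z - w‖ := by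
    have h4 : ‖z' - w‖ ≤ ‖z' - z‖ + ‖z - w‖ := norm_sub_le_norm_sub_add_norm_sub _ _ _
    rw [norm_sub_rev z' z] at h4
    linarith
  have h5 := Real.log_le_log p1 h3
  rw [Real.log_mul two_ne_zero p2.ne'] at h5
  linarith

theorem continuousAt_setLIntegral_logKernel_compl {ω : Measure ℂ} [IsFiniteMeasure ω] (c : ℝ)
    {B : Set ℂ} (hB : IsOpen B) {ζ : ℂ} (hζ : ζ ∈ B) :
    ContinuousAt (fun z => ∫⁻ w in Bᶜ, logKernel c z w ∂ω) ζ := by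
  obtain ⟨ρ, hρ, hball⟩ := Metric.isOpen_iff.mp hB ζ hζ
  refine tendsto_lintegral_filter_of_dominated_convergence
    (fun _ => ENNReal.ofReal (c - Real.log (ρ / 2)))
    (Eventually.of_forall fun z => measurable_logKernel c z) ?_ (by simp; finiteness) ?_
  · filter_upwards [Metric.ball_mem_nhds ζ (half_pos hρ)] with z hz
    refine (ae_restrict_iff' hB.measurableSet.compl).mpr (Eventually.of_forall fun w hw => ?_)
    have h1 : ρ ≤ ‖ζ - w‖ := by
      by_contra! h
      exact hw (hball (by rwa [mem_ball_iff_norm']))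
    rw [mem_ball_iff_norm'] at hz
    have h2 : ‖ζ - w‖ ≤ ‖ζ - z‖ + ‖z - w‖ := norm_sub_le_norm_sub_add_norm_sub _ _ _
    have h3 : ρ / 2 ≤ ‖z - w‖ := by linarith
    rw [logKernel_of_ne c (sub_ne_zero.mp (norm_pos_iff.mp (by linarith)))]
    refine ENNReal.ofReal_le_ofReal ?_
    linarith [Real.log_le_log (half_pos hρ) h3]
  · exact Eventually.of_forall fun w =>
      ((continuous_logKernel c).comp (Continuous.prodMk_left w)).tendsto ζ

/-- The continuity principle: an upper bound for the kernel potential on the support of the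
measure persists asymptotically near the support. -/
theorem eventually_kernelPotential_lt {ω : Measure ℂ} [IsFiniteMeasure ω] {c : ℝ} {J v : ℝ≥0∞}
    (hJ : J ≠ ∞) (hU : ∀ z ∈ ω.support, kernelPotential c ω z ≤ J) {ζ : ℂ} (hζ : ζ ∈ ω.support)
    (hv : J < v) : ∀ᶠ z in 𝓝 ζ, kernelPotential c ω z < v := by
  -- The kernel is infinite on the diagonal, so finiteness of the potential at `ζ` excludes an atom.
  -- Hence `B` below can carry less mass than `v - J`.
  have hatom : ω {ζ} = 0 := by
    have h1 : ∀ᵐ w ∂ω, logKernel c ζ w < ∞ :=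
      ae_lt_top (measurable_logKernel c ζ) (ne_top_of_le_ne_top hJ (hU ζ hζ))
    refine measure_mono_null ?_ h1
    rintro _ rfl
    simp [logKernel_self]
  obtain ⟨B, hB1, hB2, hB3⟩ := Set.exists_isOpen_lt_of_lt (μ := ω) {ζ} (v - J)
    (by rw [hatom]; exact tsub_pos_of_lt hv)
  have hζB : ζ ∈ B := hB1 rfl
  have hcl : IsClosed ω.support := Measure.isClosed_support
  have hproj : ∀ z : ℂ, ∃ z' ∈ ω.support, ∀ w ∈ ω.support, ‖z - z'‖ ≤ ‖z - w‖ := by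
    intro z
    obtain ⟨z', h1, h2⟩ := hcl.exists_infDist_eq_dist ⟨ζ, hζ⟩ z
    refine ⟨z', h1, fun w hw => ?_⟩
    rw [← dist_eq_norm, ← dist_eq_norm, ← h2]
    exact Metric.infDist_le_dist_of_mem hw
  choose π hπ1 hπ2 using hproj
  have hπ : Tendsto π (𝓝 ζ) (𝓝 ζ) := by
    rw [tendsto_iff_norm_sub_tendsto_zero]
    have h0 : Tendsto (fun z : ℂ => 2 * ‖z - ζ‖) (𝓝 ζ) (𝓝 0) := by
      have : Tendsto (fun z : ℂ => 2 * ‖z - ζ‖) (𝓝 ζ) (𝓝 (2 * ‖ζ - ζ‖)) :=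
        Continuous.tendsto (by fun_prop) ζ
      simpa using this
    refine squeeze_zero (fun _ => norm_nonneg _) (fun z => ?_) h0
    have h1 := hπ2 z ζ hζ
    have h2 : ‖π z - ζ‖ ≤ ‖π z - z‖ + ‖z - ζ‖ := norm_sub_le_norm_sub_add_norm_sub _ _ _
    rw [norm_sub_rev (π z) z] at h2
    linarith
  set h : ℂ → ℝ≥0∞ := fun z => ∫⁻ w in Bᶜ, logKernel c z w ∂ω with hh
  have hsplit : ∀ z, kernelPotential c ω z = (∫⁻ w in B, logKernel c z w ∂ω) + h z :=
    fun z => (lintegral_add_compl _ hB2.measurableSet).symm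
  have hhJ : ∀ z ∈ ω.support, h z ≤ J := fun z hz =>
    le_trans (by rw [hsplit z]; exact le_add_self) (hU z hz)
  have hcont : Tendsto h (𝓝 ζ) (𝓝 (h ζ)) := continuousAt_setLIntegral_logKernel_compl c hB2 hζB
  -- Only the part of the potential from `B` can jump. It is compared with its value at the nearest
  -- support point `π z`, where it is at most `J - h (π z)`, at a cost of `log 2 * ω B ≤ ω B`. The
  -- part `h` from `Bᶜ` is continuous at `ζ`.
  have hbound : ∀ z, kernelPotential c ω z ≤ (J - h (π z)) + ω B + h z := by
    intro z
    rw [hsplit z]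
    gcongr
    have h1 : ∫⁻ w in B, logKernel c z w ∂ω
        ≤ ∫⁻ w in B, (logKernel c (π z) w + ENNReal.ofReal (Real.log 2)) ∂ω := by
      refine lintegral_mono_ae (ae_restrict_of_ae ?_)
      filter_upwards [ae_mem_of_measure_compl_eq_zero (Measure.measure_compl_support (μ := ω))]
        with w hw using logKernel_le_add_log_two c (hπ2 z) hw
    refine h1.trans ?_
    rw [lintegral_add_right _ measurable_const, setLIntegral_const]
    have h2 : ENNReal.ofReal (Real.log 2) * ω B ≤ ω B := by
      refine mul_le_of_le_one_left bot_le ?_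
      rw [ENNReal.ofReal_le_one]
      linarith [Real.log_two_lt_d9]
    refine add_le_add ?_ h2
    refine ENNReal.le_sub_of_add_le_right (ne_top_of_le_ne_top hJ (hhJ _ (hπ1 z))) ?_
    rw [← hsplit]
    exact hU _ (hπ1 z)
  have hlim : Tendsto (fun z => (J - h (π z)) + ω B + h z) (𝓝 ζ) (𝓝 ((J - h ζ) + ω B + h ζ)) :=
    ((ENNReal.Tendsto.sub tendsto_const_nhds (hcont.comp hπ) (Or.inl hJ)).add
      tendsto_const_nhds).add hcont
  have hlt : (J - h ζ) + ω B + h ζ < v := by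
    rw [add_right_comm, tsub_add_cancel_of_le (hhJ ζ hζ)]
    exact lt_tsub_iff_left.mp hB3
  filter_upwards [hlim.eventually_lt_const hlt] with z hz using (hbound z).trans_lt hz

/-- Frostman's inequality off the support, for a measure whose kernel potential is at most `J` on
its support. -/
theorem sub_le_realPotential {ω : Measure ℂ} [IsProbabilityMeasure ω] {R c j : ℝ}
    (hS : ω.support ⊆ Metric.closedBall 0 R) (hc : 2 * R + 1 ≤ Real.exp c) (hj : 0 ≤ j)
    (hU : ∀ z ∈ ω.support, kernelPotential c ω z ≤ ENNReal.ofReal j) {z : ℂ}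
    (hz : z ∉ ω.support) : c - j ≤ realPotential ω z := by
  by_contra! hlt
  set S := ω.support with hSdef
  have hScl : IsClosed S := Measure.isClosed_support
  have hScpt : IsCompact S := (isCompact_closedBall 0 R).of_isClosed_subset hScl hS
  have hnull : ω Sᶜ = 0 := Measure.measure_compl_support
  have hharm := harmonicOnNhd_realPotential hScpt hnull
  set P := realPotential ω with hP
  set T := {w | w ∉ S ∧ P w ≤ P z} with hT
  have hTbdd : Bornology.IsBounded T := by
    have h1 := (tendsto_realPotential_atTop hScpt hnull).eventually_gt_atTop (P z)
    rw [Bornology.isBounded_def]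
    filter_upwards [h1] with w hw hwT using absurd hwT.2 (not_le.mpr hw)
  -- The sublevel set cannot accumulate on the support: by the continuity principle the kernel
  -- potential stays below `c - P z` near it, that is `P > P z`. The `+ 1` in `hc` keeps the kernel
  -- untruncated within distance `1` of the support.
  have hTcl : IsClosed T := by
    refine isClosed_of_closure_subset fun ζ hζ => ?_
    rw [mem_closure_iff_frequently] at hζ
    have hζS : ζ ∉ S := by
      intro hζS
      have h1 := eventually_kernelPotential_lt ENNReal.ofReal_ne_top hU hζS
        (v := ENNReal.ofReal (c - P z)) ((ENNReal.ofReal_lt_ofReal_iff (by linarith)).mpr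
          (by linarith))
      have h2 := Metric.ball_mem_nhds ζ one_pos
      obtain ⟨w, hw, hw1, hw2⟩ := (hζ.and_eventually (h1.and h2)).exists
      rw [kernelPotential_eq_ofReal hScpt hnull hw.1] at hw1
      · exact absurd hw1 (not_lt.mpr (ENNReal.ofReal_le_ofReal (by linarith [hw.2])))
      · intro y hy
        have e1 := mem_closedBall_zero_iff.mp (hS hζS)
        have e2 := mem_closedBall_zero_iff.mp (hS hy)
        rw [dist_eq_norm] at hw2
        have e3 : ‖w - y‖ ≤ ‖w - ζ‖ + ‖ζ - y‖ := norm_sub_le_norm_sub_add_norm_sub _ _ _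
        linarith [norm_sub_le ζ y]
    refine ⟨hζS, ?_⟩
    by_contra! h
    have hcont : ContinuousAt P ζ := (hharm ζ hζS).1.continuousAt
    obtain ⟨w, hw, hw1⟩ := (hζ.and_eventually (hcont.eventually_const_lt h)).exists
    exact absurd hw.2 (not_le.mpr hw1)
  have hTcpt : IsCompact T := Metric.isCompact_of_isClosed_isBounded hTcl hTbdd
  have hcontT : ContinuousOn P T := fun w hw => (hharm w hw.1).1.continuousAt.continuousWithinAt
  obtain ⟨z₁, hz₁, hmin⟩ := hTcpt.exists_isMinOn ⟨z, hz, le_rfl⟩ hcontT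
  have hmin' : ∀ w, w ∉ S → P z₁ ≤ P w := by
    intro w hw
    rcases le_total (P w) (P z) with h | h
    · exact hmin ⟨hw, h⟩
    · exact hz₁.2.trans h
  -- The minimizers off `S` form a closed set, open by the local minimum principle. Being nonempty,
  -- it is all of `ℂ`, yet it is bounded. This needs no connectedness of the complement of `S`.
  set M := {w | w ∈ T ∧ P w ≤ P z₁} with hM
  have hMcl : IsClosed M := by
    have := hcontT.preimage_isClosed_of_isClosed hTcl (isClosed_Iic (a := P z₁))
    exact this
  have hMopen : IsOpen M := by
    rw [Metric.isOpen_iff]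
    intro w hw
    obtain ⟨r, hr, hball⟩ := Metric.isOpen_iff.mp hScl.isOpen_compl w hw.1.1
    refine ⟨r, hr, fun y hy => ?_⟩
    have h1 := eqOn_ball_of_harmonicOnNhd_of_le (hharm.mono hball)
      (fun x hx => hw.2.trans (hmin' x (hball hx))) y hy
    exact ⟨⟨hball hy, h1.le.trans (hw.2.trans hz₁.2)⟩, h1.le.trans hw.2⟩
  have huniv : M = Set.univ := IsClopen.eq_univ ⟨hMcl, hMopen⟩ ⟨z₁, hz₁, le_rfl⟩
  have hbd : Bornology.IsBounded (Set.univ : Set ℂ) :=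
    huniv ▸ hTbdd.subset fun w hw => hw.1
  exact NormedSpace.unbounded_univ ℝ ℂ hbd

/-! ### The Green's function -/

theorem exists_exp_bound (R : ℝ) : ∃ c : ℝ, 0 ≤ c ∧ R ≤ Real.exp c := by
  refine ⟨Real.log (max 1 R), Real.log_nonneg (le_max_left _ _), ?_⟩
  rw [Real.exp_log (lt_max_of_lt_left one_pos)]
  exact le_max_right _ _

theorem logPotential_eq_realPotential {μ : Measure ℂ} [IsProbabilityMeasure μ] {K : Set ℂ}
    (hK : IsCompact K) (hμ : μ Kᶜ = 0) {z : ℂ} (hz : z ∉ K) :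
    logPotential μ z = (realPotential μ z : ℝ) := by
  obtain ⟨R, hR, hKR⟩ := hK.isBounded.subset_closedBall_lt 0 0
  obtain ⟨c, hc, hRc⟩ := exists_exp_bound (‖z‖ + R)
  have hbd : ∀ w ∈ K, ‖z - w‖ ≤ Real.exp c := fun w hw => by
    have := mem_closedBall_zero_iff.mp (hKR hw)
    linarith [norm_sub_le z w]
  have hle : realPotential μ z ≤ c := by
    have h1 : realPotential μ z ≤ ∫ _, c ∂μ := by
      refine integral_mono_ae (integrable_log_norm_sub hK hμ hz) (integrable_const _) ?_
      filter_upwards [ae_mem_of_measure_compl_eq_zero hμ] with w hw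
      have h2 := log_enorm_sub_le (hbd w hw)
      rwa [log_enorm_sub (by rintro rfl; exact hz hw), EReal.coe_le_coe_iff] at h2
    simpa using h1
  rw [logPotential_eq_sub_kernelPotential hμ hc hbd, probReal_univ, mul_one,
    kernelPotential_eq_ofReal hK hμ hz hbd, EReal.coe_ennreal_ofReal,
    max_eq_left (by linarith), ← EReal.coe_sub]
  simp

/-- Frostman's inequality for the equilibrium measure, off the set. -/
theorem IsEquilibriumMeasure.exists_logEnergy_eq_and_le {K : Set ℂ} (hK : IsCompact K)
    {ω : Measure ℂ} (hω : IsEquilibriumMeasure K ω) (hbot : logEnergy ω ≠ ⊥) :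
    ∃ I : ℝ, logEnergy ω = I ∧ ∀ z ∉ K, I ≤ realPotential ω z := by
  obtain ⟨hprob, hωK, hmax⟩ := hω
  obtain ⟨R, hR, hKR⟩ := hK.isBounded.subset_closedBall_lt 0 0
  obtain ⟨c, hc, hRc⟩ := exists_exp_bound (2 * R + 1)
  have hbd : ∀ z ∈ K, ∀ w ∈ K, ‖z - w‖ ≤ Real.exp c := fun z hz w hw => by
    have h1 := mem_closedBall_zero_iff.mp (hKR hz)
    have h2 := mem_closedBall_zero_iff.mp (hKR hw)
    linarith [norm_sub_le z w]
  have hE := logEnergy_eq_sub_kernelEnergy hωK hc hbd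
  rw [probReal_univ, one_pow, mul_one] at hE
  have hfin : kernelEnergy c ω ω ≠ ∞ := by
    intro h
    rw [h] at hE
    exact hbot (by simpa using hE)
  have hmin : ∀ μ : Measure ℂ, IsProbabilityMeasure μ → μ Kᶜ = 0 →
      kernelEnergy c ω ω ≤ kernelEnergy c μ μ := by
    intro μ hμ hμK
    by_contra! hlt
    have h1 := hmax μ hμ hμK
    rw [hE, logEnergy_eq_sub_kernelEnergy hμK hc hbd, probReal_univ, one_pow, mul_one] at h1
    lift kernelEnergy c ω ω to ℝ≥0 using hfin with a
    lift kernelEnergy c μ μ to ℝ≥0 using hlt.ne_top with b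
    rw [EReal.coe_nnreal_eq_coe_real, EReal.coe_nnreal_eq_coe_real, ← EReal.coe_sub,
      ← EReal.coe_sub, EReal.coe_le_coe_iff] at h1
    have h2 : (b : ℝ) < a := by exact_mod_cast hlt
    linarith
  have hsupp : ω.support ⊆ K := Measure.support_subset_of_isClosed hK.isClosed hωK
  refine ⟨c - (kernelEnergy c ω ω).toReal, ?_, fun z hz => ?_⟩
  · rw [hE, EReal.coe_sub, EReal.coe_ennreal_toReal hfin]
  · refine sub_le_realPotential (hsupp.trans hKR) hRc ENNReal.toReal_nonneg (fun w hw => ?_)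
      (fun h => hz (hsupp h))
    rw [ENNReal.ofReal_toReal hfin]
    exact kernelPotential_le_of_mem_support hωK hfin hmin hw

/-- Equality at one point would make the potential constant on the connected complement by the
minimum principle, although it tends to `∞`. -/
theorem IsEquilibriumMeasure.exists_logEnergy_eq_and_lt {K : Set ℂ} (hK : IsCompact K)
    (hconn : IsPreconnected Kᶜ) {ω : Measure ℂ} (hω : IsEquilibriumMeasure K ω)
    (hbot : logEnergy ω ≠ ⊥) :
    ∃ I : ℝ, logEnergy ω = I ∧ ∀ z ∉ K, I < realPotential ω z := by
  obtain ⟨I, hI, hle⟩ := hω.exists_logEnergy_eq_and_le hK hbot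
  have := hω.1
  refine ⟨I, hI, fun z hz => lt_of_le_of_ne (hle z hz) fun heq => ?_⟩
  have h1 := eqOn_of_harmonicOnNhd_of_le hK.isClosed.isOpen_compl hconn
    (harmonicOnNhd_realPotential hK hω.2.1) hz (fun w hw => heq ▸ hle w hw)
  have h2 := (tendsto_realPotential_atTop hK hω.2.1).eventually_gt_atTop I
  have h3 : ∀ᶠ w in Bornology.cobounded ℂ, w ∈ Kᶜ := hK.isBounded
  obtain ⟨w, hw1, hw2⟩ := (h2.and h3).exists
  have h4 : realPotential ω w = realPotential ω z := h1 hw2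
  rw [h4, heq] at hw1
  exact lt_irrefl _ hw1

/-! ### Existence of the equilibrium measure -/

theorem kernelEnergy_eq_iSup_lintegral_prod (c : ℝ) (μ : Measure ℂ) [SFinite μ] :
    kernelEnergy c μ μ = ⨆ n : ℕ, ∫⁻ p, min (logKernel c p.1 p.2) n ∂(μ.prod μ) := by
  have hm := (continuous_logKernel c).measurable
  rw [← lintegral_iSup (fun n => hm.min measurable_const)
    fun n m hnm p => min_le_min_left _ (by exact_mod_cast hnm)]
  have h : ∀ p : ℂ × ℂ, ⨆ n : ℕ, min (logKernel c p.1 p.2) n = logKernel c p.1 p.2 := by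
    intro p
    rw [← inf_iSup_eq (logKernel c p.1 p.2) fun n : ℕ => (n : ℝ≥0∞), ENNReal.iSup_natCast]
    exact inf_top_eq _
  simp_rw [h]
  rw [lintegral_prod _ hm.aemeasurable]
  rfl

/-- The truncations `min (logKernel c) n` are bounded and continuous, so their double integrals are
weakly continuous in `μ`, because `μ ↦ μ.prod μ` is. The energy is their supremum. -/
theorem lowerSemicontinuous_kernelEnergy (c : ℝ) :
    LowerSemicontinuous fun μ : ProbabilityMeasure ℂ => kernelEnergy c (μ : Measure ℂ) μ := by
  simp_rw [kernelEnergy_eq_iSup_lintegral_prod]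
  refine lowerSemicontinuous_iSup fun n => Continuous.lowerSemicontinuous ?_
  have hne : ∀ p : ℂ × ℂ, min (logKernel c p.1 p.2) n ≠ ∞ := fun p =>
    ne_top_of_le_ne_top (ENNReal.natCast_ne_top n) (min_le_right _ _)
  have hcont : Continuous fun p : ℂ × ℂ => (min (logKernel c p.1 p.2) n).toNNReal :=
    ENNReal.continuousOn_toNNReal.comp_continuous
      ((continuous_logKernel c).min continuous_const) hne
  let f : BoundedContinuousFunction (ℂ × ℂ) ℝ≥0 :=
    BoundedContinuousFunction.mkOfBound ⟨_, hcont⟩ n fun x y => by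
      have h : ∀ p : ℂ × ℂ, ((min (logKernel c p.1 p.2) n).toNNReal : ℝ) ≤ n := fun p => by
        have := ENNReal.toNNReal_mono (ENNReal.natCast_ne_top n)
          (min_le_right (logKernel c p.1 p.2) n)
        rw [ENNReal.toNNReal_natCast] at this
        exact_mod_cast this
      rw [NNReal.dist_eq, abs_le]
      simp only [ContinuousMap.coe_mk]
      constructor <;> linarith [h x, h y, NNReal.coe_nonneg (min (logKernel c x.1 x.2) n).toNNReal,
        NNReal.coe_nonneg (min (logKernel c y.1 y.2) n).toNNReal]
  have hf : ∀ μ : ProbabilityMeasure ℂ,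
      ∫⁻ p, min (logKernel c p.1 p.2) n ∂((μ : Measure ℂ).prod μ)
        = ∫⁻ p, f p ∂(μ.prod μ : ProbabilityMeasure (ℂ × ℂ)) := fun μ =>
    lintegral_congr fun p => (ENNReal.coe_toNNReal (hne p)).symm
  simp_rw [hf]
  refine continuous_iff_continuousAt.mpr fun μ => ?_
  have hprod : Tendsto (fun ν : ProbabilityMeasure ℂ => ν.prod ν) (𝓝 μ) (𝓝 (μ.prod μ)) :=
    ((ProbabilityMeasure.continuous_prod (α := ℂ) (β := ℂ)).comp
      (continuous_id.prodMk continuous_id)).tendsto μ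
  exact ProbabilityMeasure.tendsto_iff_forall_lintegral_tendsto.mp hprod f

/-- A compact non-polar set has an equilibrium measure, and its energy is finite. -/
theorem exists_isEquilibriumMeasure {K : Set ℂ} (hK : IsCompact K) (hpolar : ¬ IsPolar K) :
    (∃ ω, IsEquilibriumMeasure K ω) ∧ ∀ ω, IsEquilibriumMeasure K ω → logEnergy ω ≠ ⊥ := by
  obtain ⟨R, hR, hKR⟩ := hK.isBounded.subset_closedBall_lt 0 0
  obtain ⟨c, hc, hRc⟩ := exists_exp_bound (2 * R + 1)
  have hbd : ∀ z ∈ K, ∀ w ∈ K, ‖z - w‖ ≤ Real.exp c := fun z hz w hw => by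
    have h1 := mem_closedBall_zero_iff.mp (hKR hz)
    have h2 := mem_closedBall_zero_iff.mp (hKR hw)
    linarith [norm_sub_le z w]
  have hE : ∀ μ : Measure ℂ, IsProbabilityMeasure μ → μ Kᶜ = 0 →
      logEnergy μ = (c : EReal) - (kernelEnergy c μ μ : EReal) := fun μ hμ hμK => by
    have h := logEnergy_eq_sub_kernelEnergy hμK hc hbd
    rwa [probReal_univ, one_pow, mul_one] at h
  obtain ⟨μ, hμfin, hμ0, hμK, hμE⟩ : ∃ μ : Measure ℂ, IsFiniteMeasure μ ∧ μ ≠ 0 ∧ μ Kᶜ = 0 ∧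
      logEnergy μ ≠ ⊥ := by
    unfold IsPolar at hpolar
    push Not at hpolar
    obtain ⟨μ, h1, h2, ⟨C, -, hCK, hμC⟩, h3⟩ := hpolar
    exact ⟨μ, h1, h2, measure_mono_null (Set.compl_subset_compl.mpr hCK) hμC, h3⟩
  have hμJ : kernelEnergy c μ μ ≠ ∞ := by
    intro h
    rw [logEnergy_eq_sub_kernelEnergy hμK hc hbd, h] at hμE
    generalize c * μ.real Set.univ ^ 2 = d at hμE
    simp at hμE
  set μ₁ := (μ Set.univ)⁻¹ • μ with hμ₁
  have : NeZero μ := ⟨hμ0⟩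
  have hprob : IsProbabilityMeasure μ₁ := inferInstance
  have hμ₁K : μ₁ Kᶜ = 0 := by simp [hμ₁, hμK]
  have hμ₁J : kernelEnergy c μ₁ μ₁ ≠ ∞ := by
    rw [hμ₁, kernelEnergy_smul_left, kernelEnergy_smul_right]
    have : (μ Set.univ)⁻¹ ≠ ∞ := by simpa using hμ0
    finiteness
  constructor
  -- The constant sequences turn the tightness criterion into weak compactness of the set of
  -- probability measures carried by `K`.
  · have hcpt : IsCompact {m : ProbabilityMeasure ℂ |
        ∀ n : ℕ, m ((fun _ => K) n)ᶜ ≤ (fun _ => (0 : ℝ≥0)) n} :=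
      isCompact_setOfPred_probabilityMeasure_mass_eq_compl_isCompact_le tendsto_const_nhds
        (fun _ => hK) (Or.inl inferInstance)
    have hiff : ∀ m : ProbabilityMeasure ℂ, m Kᶜ ≤ 0 ↔ (m : Measure ℂ) Kᶜ = 0 := fun m => by
      rw [nonpos_iff_eq_zero, ProbabilityMeasure.null_iff_toMeasure_null]
    have hne : {m : ProbabilityMeasure ℂ |
        ∀ n : ℕ, m ((fun _ => K) n)ᶜ ≤ (fun _ => (0 : ℝ≥0)) n}.Nonempty :=
      ⟨⟨μ₁, hprob⟩, fun _ => (hiff ⟨μ₁, hprob⟩).mpr hμ₁K⟩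
    obtain ⟨ω, hω, hmin⟩ := LowerSemicontinuousOn.exists_isMinOn hne hcpt
      ((lowerSemicontinuous_kernelEnergy c).lowerSemicontinuousOn _)
    have hωK := (hiff ω).mp (hω 0)
    refine ⟨ω, ω.2, hωK, fun ν hν hνK => ?_⟩
    rw [hE ν hν hνK, hE ω ω.2 hωK]
    refine EReal.sub_le_sub le_rfl (EReal.coe_ennreal_le_coe_ennreal_iff.mpr ?_)
    exact hmin (show (⟨ν, hν⟩ : ProbabilityMeasure ℂ) ∈ _ from fun _ => (hiff ⟨ν, hν⟩).mpr hνK)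
  · intro ω hω hbot
    have h := hω.2.2 μ₁ hprob hμ₁K
    rw [hbot, le_bot_iff, hE μ₁ hprob hμ₁K, ← ENNReal.ofReal_toReal hμ₁J,
      EReal.coe_ennreal_ofReal, ← EReal.coe_sub] at h
    exact EReal.coe_ne_bot _ h

/-- The Green's function of a compact non-polar set with connected complement is the potential of
a probability measure on the set minus a constant, and it is positive. -/
theorem exists_greenFunction_eq {K : Set ℂ} (hK : IsCompact K) (hpolar : ¬ IsPolar K)
    (hconn : IsPreconnected Kᶜ) :
    ∃ (ω : Measure ℂ) (I : ℝ), IsProbabilityMeasure ω ∧ ω Kᶜ = 0 ∧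
      (∀ z ∉ K, greenFunction K z = realPotential ω z - I) ∧ ∀ z ∉ K, I < realPotential ω z := by
  obtain ⟨hex, hbot⟩ := exists_isEquilibriumMeasure hK hpolar
  have hω : IsEquilibriumMeasure K (equilibriumMeasure K) := by
    rw [equilibriumMeasure, dif_pos hex]
    exact hex.choose_spec
  obtain ⟨I, hI, hlt⟩ := hω.exists_logEnergy_eq_and_lt hK hconn (hbot _ hω)
  have := hω.1
  refine ⟨_, I, hω.1, hω.2.1, fun z hz => ?_, hlt⟩
  rw [greenFunction, logPotential_eq_realPotential hK hω.2.1 hz, hI, ← EReal.coe_sub,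
    EReal.toReal_coe]

/-! ### Root distributions -/

theorem integral_sum_map_dirac (s : Multiset ℂ) (f : ℂ → ℝ) :
    Integrable f (s.map Measure.dirac).sum ∧
      ∫ z, f z ∂(s.map Measure.dirac).sum = (s.map f).sum := by
  induction s using Multiset.induction_on with
  | empty => simp
  | cons a s ih =>
    have h : Integrable f (Measure.dirac a) := integrable_dirac (by simp)
    simp only [Multiset.map_cons, Multiset.sum_cons]
    exact ⟨h.add_measure ih.1, by rw [integral_add_measure h ih.1, ih.2, integral_dirac]⟩

theorem sum_map_dirac_apply (s : Multiset ℂ) {L : Set ℂ} [DecidablePred (· ∈ L)]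
    (hL : MeasurableSet L) :
    (s.map Measure.dirac).sum L = (s.countP (· ∈ L) : ℝ≥0∞) := by
  induction s using Multiset.induction_on with
  | empty => simp
  | cons a s ih =>
    simp only [Multiset.map_cons, Multiset.sum_cons, Measure.add_apply, ih,
      Multiset.countP_cons, Measure.dirac_apply' a hL]
    by_cases h : a ∈ L <;> simp [h, add_comm]

theorem integral_rootDistribution (q : ℂ[X]) (f : ℂ → ℝ) :
    ∫ z, f z ∂(rootDistribution q) = (q.natDegree : ℝ)⁻¹ * (q.roots.map f).sum := by
  rw [rootDistribution, integral_smul_measure, (integral_sum_map_dirac _ _).2]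
  simp

theorem natDegree_mul_rootDistribution_apply {q : ℂ[X]} (hq : 0 < q.natDegree) {L : Set ℂ}
    [DecidablePred (· ∈ L)] (hL : MeasurableSet L) :
    (q.natDegree : ℝ≥0∞) * rootDistribution q L = (q.roots.countP (· ∈ L) : ℝ≥0∞) := by
  rw [rootDistribution, Measure.smul_apply, sum_map_dirac_apply _ hL, smul_eq_mul, ← mul_assoc,
    ENNReal.mul_inv_cancel (by exact_mod_cast hq.ne') (by finiteness), one_mul]

theorem card_roots_eq_natDegree (q : ℂ[X]) : q.roots.card = q.natDegree :=
  (splits_iff_card_roots.mp (IsAlgClosed.splits q))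

theorem isProbabilityMeasure_rootDistribution {q : ℂ[X]} (hq : 0 < q.natDegree) :
    IsProbabilityMeasure (rootDistribution q) := by
  have h : ∀ s : Multiset ℂ, (s.map Measure.dirac).sum Set.univ = (s.card : ℝ≥0∞) := by
    intro s
    induction s using Multiset.induction_on with
    | empty => simp
    | cons a s ih => simp [ih, add_comm]
  constructor
  rw [rootDistribution, Measure.smul_apply, h, card_roots_eq_natDegree, smul_eq_mul]
  exact ENNReal.inv_mul_cancel (by exact_mod_cast hq.ne') (by finiteness)

theorem log_norm_eval {q : ℂ[X]} {z : ℂ} (hz : q.eval z ≠ 0) :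
    Real.log ‖q.eval z‖ = Real.log ‖q.leadingCoeff‖
      + (q.roots.map fun w => Real.log ‖z - w‖).sum := by
  have hq : q ≠ 0 := by rintro rfl; simp at hz
  have h1 : q.eval z = q.leadingCoeff * (q.roots.map fun w => z - w).prod := by
    conv_lhs => rw [(IsAlgClosed.splits q).eq_prod_roots]
    rw [eval_mul, eval_C, eval_multiset_prod, Multiset.map_map]
    simp
  have h2 : ∀ s : Multiset ℂ, z ∉ s → Real.log ‖(s.map fun w => z - w).prod‖
      = (s.map fun w => Real.log ‖z - w‖).sum := by
    intro s
    induction s using Multiset.induction_on with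
    | empty => simp
    | cons a s ih =>
      intro hs
      rw [Multiset.mem_cons, not_or] at hs
      have h3 : (s.map fun w => z - w).prod ≠ 0 := by
        rw [Ne, Multiset.prod_eq_zero_iff, Multiset.mem_map]
        rintro ⟨w, hw, hw0⟩
        exact hs.2 (sub_eq_zero.mp hw0 ▸ hw)
      rw [Multiset.map_cons, Multiset.prod_cons, norm_mul, Real.log_mul
        (norm_ne_zero_iff.mpr (sub_ne_zero.mpr hs.1)) (norm_ne_zero_iff.mpr h3), ih hs.2,
        Multiset.map_cons, Multiset.sum_cons]
  have h4 : z ∉ q.roots := fun h => hz (isRoot_of_mem_roots h)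
  have h5 : (q.roots.map fun w => z - w).prod ≠ 0 := by
    intro h
    rw [h, mul_zero] at h1
    exact hz h1
  rw [h1, norm_mul, Real.log_mul (norm_ne_zero_iff.mpr (leadingCoeff_ne_zero.mpr hq))
    (norm_ne_zero_iff.mpr h5), h2 _ h4]

theorem rootDistribution_sub_C (q : ℂ[X]) (hq : 0 < q.natDegree) (a : ℂ) :
    rootDistribution (q - C a) = valueDistribution q a := by
  classical
  have h0 : q - C a ≠ 0 := by
    intro h
    rw [sub_eq_zero] at h
    rw [h, natDegree_C] at hq
    exact lt_irrefl _ hq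
  have hset : {z : ℂ | q.eval z = a} = ((q - C a).roots.toFinset : Set ℂ) := by
    ext z
    simp [h0, sub_eq_zero]
  rw [rootDistribution, valueDistribution, natDegree_sub_C, hset, finsum_mem_coe_finset,
    Finset.sum_multiset_map_count]
  congr 1
  refine Finset.sum_congr rfl fun z _ => ?_
  rw [count_roots]
  ext s
  simp

theorem rootDistribution_compl_eq_zero {q : ℂ[X]} {L : Set ℂ} (hL : MeasurableSet L)
    (h : ∀ z ∈ q.roots, z ∈ L) : rootDistribution q Lᶜ = 0 := by
  classical
  rw [rootDistribution, Measure.smul_apply, sum_map_dirac_apply _ hL.compl,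
    Multiset.countP_eq_zero.mpr fun z hz hzL => hzL (h z hz)]
  simp

theorem inv_mul_log_norm_eval {q : ℂ[X]} {z : ℂ} (hz : q.eval z ≠ 0) :
    1 / (q.natDegree : ℝ) * Real.log ‖q.eval z‖
      = 1 / (q.natDegree : ℝ) * Real.log ‖q.leadingCoeff‖
        + realPotential (rootDistribution q) z := by
  rw [log_norm_eval hz, realPotential, integral_rootDistribution, mul_add, one_div]

theorem exists_pos_forall_roots_norm_le (q : ℂ[X]) : ∃ R : ℝ, 0 < R ∧ ∀ z ∈ q.roots, ‖z‖ ≤ R := by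
  classical
  obtain ⟨R, hR, h⟩ := (q.roots.toFinset.finite_toSet.isBounded).subset_closedBall_lt 0 0
  exact ⟨R, hR, fun z hz => mem_closedBall_zero_iff.mp (h (by simpa using hz))⟩

/-- The normalized logarithm of the leading coefficient is the value at `∞` of `(1/n) log |q_k| -
log |z|`, and `-I` is that of `p_ω - I - log |z|`. Letting `z → ∞` in the uniform estimate, with `k`
fixed, compares them; the radius `Rk` enclosing the roots may therefore depend on `k`. -/
theorem tendsto_log_leadingCoeff {K : Set ℂ} (hK : IsCompact K) {q : ℕ → ℂ[X]}
    (hpos : ∀ k, 0 < (q k).natDegree) {ω : Measure ℂ} [IsProbabilityMeasure ω] (hω : ω Kᶜ = 0)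
    {I R : ℝ}
    (hzero : ∀ᶠ k in atTop, ∀ z ∈ (Metric.ball (0 : ℂ) R)ᶜ, (q k).eval z ≠ 0)
    (hunif : TendstoUniformlyOn
      (fun k z => 1 / ((q k).natDegree : ℝ) * Real.log ‖(q k).eval z‖)
      (fun z => realPotential ω z - I) atTop (Metric.ball (0 : ℂ) R)ᶜ) :
    Tendsto (fun k => 1 / ((q k).natDegree : ℝ) * Real.log ‖(q k).leadingCoeff‖) atTop
      (𝓝 (-I)) := by
  rw [Metric.tendsto_nhds]
  intro ε hε
  filter_upwards [hzero, Metric.tendstoUniformlyOn_iff.mp hunif (ε / 2) (half_pos hε)] with k h0 hk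
  have := isProbabilityMeasure_rootDistribution (hpos k)
  obtain ⟨Rk, -, hRk⟩ := exists_pos_forall_roots_norm_le (q k)
  have h1 : rootDistribution (q k) (Metric.closedBall 0 Rk)ᶜ = 0 :=
    rootDistribution_compl_eq_zero measurableSet_closedBall
      fun z hz => mem_closedBall_zero_iff.mpr (hRk z hz)
  have h2 := tendsto_realPotential_sub_log_norm (isCompact_closedBall 0 Rk) h1
  have h3 := tendsto_realPotential_sub_log_norm hK hω
  set c := 1 / ((q k).natDegree : ℝ) * Real.log ‖(q k).leadingCoeff‖ with hc
  have h4 : Tendsto (fun z => |c + (realPotential (rootDistribution (q k)) z - Real.log ‖z‖)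
      - (realPotential ω z - Real.log ‖z‖) + I|) (Bornology.cobounded ℂ)
      (𝓝 |c + 0 - 0 + I|) := (((h2.const_add c).sub h3).add_const I).abs
  have h5 : |c + 0 - 0 + I| ≤ ε / 2 := by
    refine le_of_tendsto h4 ?_
    filter_upwards [tendsto_norm_cobounded_atTop.eventually_ge_atTop R] with z hz
    have hzR : z ∈ (Metric.ball (0 : ℂ) R)ᶜ := by
      rw [Set.mem_compl_iff, mem_ball_zero_iff]; exact hz.not_gt
    have h6 := hk z hzR
    rw [inv_mul_log_norm_eval (h0 z hzR), dist_comm, Real.dist_eq] at h6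
    refine le_trans (le_of_eq ?_) h6.le
    congr 1
    ring
  rw [Real.dist_eq]
  rw [add_zero, sub_zero] at h5
  rw [sub_neg_eq_add]
  linarith

/-! ### Weak limits of root distributions -/

theorem tendsto_integral_of_continuous_of_compl_null {ι : Type*} {l : Filter ι}
    {μ : ι → ProbabilityMeasure ℂ} {ν : ProbabilityMeasure ℂ} (h : Tendsto μ l (𝓝 ν))
    {B : Set ℂ} (hB : IsCompact B) (hμ : ∀ᶠ i in l, (μ i : Measure ℂ) Bᶜ = 0)
    (hν : (ν : Measure ℂ) Bᶜ = 0) {f : ℂ → ℝ} (hf : Continuous f) :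
    Tendsto (fun i => ∫ w, f w ∂(μ i : Measure ℂ)) l (𝓝 (∫ w, f w ∂(ν : Measure ℂ))) := by
  obtain ⟨C, hC⟩ := hB.exists_bound_of_continuousOn hf.continuousOn
  set C' := max C 0 with hC'
  -- Clamping `f` to its range on `B` gives a bounded test function with the same integrals.
  have hg : Continuous fun w => max (-C') (min C' (f w)) := by fun_prop
  have hbound : ∀ w, ‖max (-C') (min C' (f w))‖ ≤ C' := by
    intro w
    have h0 : 0 ≤ C' := le_max_right _ _
    rw [Real.norm_eq_abs, abs_le]
    exact ⟨le_max_left _ _, max_le (by linarith) (min_le_left _ _)⟩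
  have heq : ∀ w ∈ B, max (-C') (min C' (f w)) = f w := by
    intro w hw
    have h1 := (hC w hw).trans (le_max_left C 0)
    rw [Real.norm_eq_abs, abs_le] at h1
    rw [min_eq_right h1.2, max_eq_right h1.1]
  have key := (ProbabilityMeasure.tendsto_iff_forall_integral_tendsto.mp h)
    (BoundedContinuousFunction.ofNormedAddCommGroup _ hg C' hbound)
  have hint : ∀ m : Measure ℂ, m Bᶜ = 0 →
      ∫ w, max (-C') (min C' (f w)) ∂m = ∫ w, f w ∂m := by
    intro m hm
    refine integral_congr_ae ?_
    filter_upwards [ae_mem_of_measure_compl_eq_zero hm] with w hw using heq w hw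
  simp only [BoundedContinuousFunction.coe_ofNormedAddCommGroup] at key
  rw [hint _ hν] at key
  refine key.congr' ?_
  filter_upwards [hμ] with i hi using hint _ hi

/-- `Kᶜ` is a countable union of open sets `{infDist > 1/(m+1)}`. The portmanteau inequality bounds
the limit mass of each by that of a closed set disjoint from `K`. -/
theorem compl_null_of_tendsto {ι : Type*} {l : Filter ι} [l.NeBot]
    {μ : ι → ProbabilityMeasure ℂ} {ν : ProbabilityMeasure ℂ} (h : Tendsto μ l (𝓝 ν))
    {K : Set ℂ} (hK : IsClosed K) (hne : K.Nonempty)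
    (hL : ∀ L : Set ℂ, IsClosed L → Disjoint L K →
      Tendsto (fun i => (μ i : Measure ℂ) L) l (𝓝 0)) : (ν : Measure ℂ) Kᶜ = 0 := by
  have h1 : ∀ m : ℕ, (ν : Measure ℂ) {w | 1 / ((m : ℝ) + 1) < Metric.infDist w K} = 0 := by
    intro m
    have hopen : IsOpen {w | 1 / ((m : ℝ) + 1) < Metric.infDist w K} :=
      isOpen_lt continuous_const (Metric.continuous_infDist_pt K)
    have hcl : IsClosed {w | 1 / ((m : ℝ) + 1) ≤ Metric.infDist w K} :=
      isClosed_le continuous_const (Metric.continuous_infDist_pt K)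
    have hdisj : Disjoint {w | 1 / ((m : ℝ) + 1) ≤ Metric.infDist w K} K := by
      rw [Set.disjoint_left]
      intro w hw hwK
      rw [Set.mem_ofPred_eq, Metric.infDist_zero_of_mem hwK] at hw
      have : (0 : ℝ) < 1 / ((m : ℝ) + 1) := by positivity
      linarith
    refine le_antisymm ?_ bot_le
    calc (ν : Measure ℂ) {w | 1 / ((m : ℝ) + 1) < Metric.infDist w K}
        ≤ liminf (fun i => (μ i : Measure ℂ) {w | 1 / ((m : ℝ) + 1) < Metric.infDist w K}) l :=
          ProbabilityMeasure.le_liminf_measure_open_of_tendsto h hopen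
      _ ≤ liminf (fun i => (μ i : Measure ℂ) {w | 1 / ((m : ℝ) + 1) ≤ Metric.infDist w K}) l :=
          liminf_le_liminf (Eventually.of_forall fun i =>
            measure_mono (Set.ofPred_subset_ofPred.mpr fun _ hw => hw.le))
      _ = 0 := (hL _ hcl hdisj).liminf_eq
  refine measure_mono_null (fun w hw => ?_) (measure_iUnion_null h1)
  obtain ⟨m, hm⟩ := exists_nat_one_div_lt ((hK.notMem_iff_infDist_pos hne).mp hw)
  exact Set.mem_iUnion.mpr ⟨m, hm⟩

theorem continuous_log_max {r : ℝ} (hr : 0 < r) (z : ℂ) :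
    Continuous fun w => Real.log (max r ‖z - w‖) :=
  Continuous.log (by fun_prop) fun w => (lt_max_of_lt_left hr).ne'

/-- Root distributions that concentrate on `K` and whose potentials converge to that of `ω` near
infinity have truncated potentials converging to the potential of `ω` off `K`. -/
theorem tendsto_integral_log_max {K : Set ℂ} (hK : IsCompact K) (hconn : IsPreconnected Kᶜ)
    {ω : Measure ℂ} [IsProbabilityMeasure ω] (hω : ω Kᶜ = 0)
    {μ : ℕ → ProbabilityMeasure ℂ} {R : ℝ} (hKR : K ⊆ Metric.ball 0 R)
    (hμR : ∀ᶠ k in atTop, (μ k : Measure ℂ) (Metric.closedBall 0 R)ᶜ = 0)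
    (hμL : ∀ L : Set ℂ, IsClosed L → Disjoint L K →
      Tendsto (fun k => (μ k : Measure ℂ) L) atTop (𝓝 0))
    (hpot : ∀ z : ℂ, R < ‖z‖ →
      Tendsto (fun k => realPotential (μ k) z) atTop (𝓝 (realPotential ω z)))
    {z₀ : ℂ} {r : ℝ} (hr : 0 < r) (hdisj : Disjoint (Metric.closedBall z₀ r) K) :
    Tendsto (fun k => ∫ w, Real.log (max r ‖z₀ - w‖) ∂(μ k : Measure ℂ)) atTop
      (𝓝 (realPotential ω z₀)) := by
  have hne : K.Nonempty := by
    by_contra h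
    rw [Set.not_nonempty_iff_eq_empty] at h
    simp [h] at hω
  -- Ultrafilters replace passing to subsequences: along each one `μ` has a weak limit `ν`, and it
  -- suffices to identify the limiting integral.
  rw [tendsto_iff_ultrafilter]
  intro u hu
  have hcpt : IsCompact {m : ProbabilityMeasure ℂ |
      ∀ n : ℕ, m ((fun _ => Metric.closedBall 0 R) n)ᶜ ≤ (fun _ => (0 : ℝ≥0)) n} :=
    isCompact_setOfPred_probabilityMeasure_mass_eq_compl_isCompact_le tendsto_const_nhds
      (fun _ => isCompact_closedBall 0 R) (Or.inl inferInstance)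
  have hBiff : ∀ m : ProbabilityMeasure ℂ, m (Metric.closedBall 0 R)ᶜ ≤ 0 ↔
      (m : Measure ℂ) (Metric.closedBall 0 R)ᶜ = 0 := by
    intro m
    rw [nonpos_iff_eq_zero, ProbabilityMeasure.null_iff_toMeasure_null]
  have hmem : ↑(u.map μ) ≤ 𝓟 {m : ProbabilityMeasure ℂ |
      ∀ n : ℕ, m ((fun _ => Metric.closedBall 0 R) n)ᶜ ≤ (fun _ => (0 : ℝ≥0)) n} := by
    rw [le_principal_iff, Ultrafilter.coe_map, mem_map]
    filter_upwards [hu hμR] with k hk _ using (hBiff _).mpr hk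
  obtain ⟨ν, hν, hlim⟩ := hcpt.ultrafilter_le_nhds _ hmem
  have hνlim : Tendsto μ u (𝓝 ν) := hlim
  have hνR : (ν : Measure ℂ) (Metric.closedBall 0 R)ᶜ = 0 := (hBiff ν).mp (hν 0)
  have hνK : (ν : Measure ℂ) Kᶜ = 0 :=
    compl_null_of_tendsto hνlim hK.isClosed hne fun L hL hLK => (hμL L hL hLK).mono_left hu
  have hconv : ∀ {f : ℂ → ℝ}, Continuous f →
      Tendsto (fun k => ∫ w, f w ∂(μ k : Measure ℂ)) u (𝓝 (∫ w, f w ∂(ν : Measure ℂ))) :=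
    fun hf => tendsto_integral_of_continuous_of_compl_null hνlim (isCompact_closedBall 0 R)
      (hu hμR) hνR hf
  have hfar : ∀ z : ℂ, R < ‖z‖ → realPotential ν z = realPotential ω z := by
    intro z hz
    have hpt : ∀ m : Measure ℂ, m (Metric.closedBall 0 R)ᶜ = 0 →
        ∫ w, Real.log (max (‖z‖ - R) ‖z - w‖) ∂m = realPotential m z := by
      intro m hm
      refine integral_congr_ae ?_
      filter_upwards [ae_mem_of_measure_compl_eq_zero hm] with w hw
      rw [mem_closedBall_zero_iff] at hw
      rw [max_eq_right (by linarith [norm_sub_norm_le z w])]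
    have h1 := hconv (continuous_log_max (sub_pos.mpr hz) z)
    rw [hpt _ hνR] at h1
    refine tendsto_nhds_unique (h1.congr' ?_) ((hpot z hz).mono_left hu)
    filter_upwards [hu hμR] with k hk using hpt _ hk
  obtain ⟨z₁, hz₁⟩ : ∃ z : ℂ, R < ‖z‖ :=
    (tendsto_norm_cobounded_atTop.eventually_gt_atTop R).exists
  have heq := realPotential_eqOn_compl (μ := (ν : Measure ℂ)) (ν := ω) hK hconn hνK hω
    (z₀ := z₁) (fun h => lt_asymm hz₁ (mem_ball_zero_iff.mp (hKR h)))
    (by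
      filter_upwards [(isOpen_lt continuous_const continuous_norm).mem_nhds hz₁] with z hz
        using hfar z hz)
  have hz₀ : z₀ ∉ K := Set.disjoint_left.mp hdisj (Metric.mem_closedBall_self hr.le)
  rw [← heq hz₀]
  -- Truncating at `r` makes the kernel continuous even though roots may lie near `z₀`. The limit
  -- does not see it, since `ν` lives on `K`, outside the closed disk of radius `r`.
  have h2 : ∫ w, Real.log (max r ‖z₀ - w‖) ∂(ν : Measure ℂ) = realPotential ν z₀ := by
    refine integral_congr_ae ?_
    filter_upwards [ae_mem_of_measure_compl_eq_zero hνK] with w hw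
    have h3 : r < ‖z₀ - w‖ := by
      by_contra! h
      exact Set.disjoint_left.mp hdisj (mem_closedBall_iff_norm'.mpr h) hw
    rw [max_eq_right h3.le]
  rw [← h2]
  exact hconv (continuous_log_max hr z₀)

/-! ### Circle averages and counting of roots -/

/-- The average of `log |q|` over the circle of radius `r` around `z`, by Jensen's formula. -/
noncomputable def jensenSum (q : ℂ[X]) (z : ℂ) (r : ℝ) : ℝ :=
  Real.log ‖q.leadingCoeff‖ + (q.roots.map fun w => Real.log (max r ‖z - w‖)).sum

theorem circleAverage_log_norm_sub_const_eq_log_max {r : ℝ} (hr : 0 < r) (z w : ℂ) :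
    Real.circleAverage (fun x => Real.log ‖x - w‖) z r = Real.log (max r ‖z - w‖) := by
  rw [circleAverage_log_norm_sub_const_eq_log_radius_add_posLog hr.ne']
  rcases le_total ‖z - w‖ r with h | h
  · have h1 : r⁻¹ * ‖z - w‖ ≤ 1 := by rwa [inv_mul_le_iff₀ hr, mul_one]
    rw [max_eq_left h, Real.posLog_eq_zero_iff _ |>.mpr, add_zero]
    rw [abs_of_nonneg (by positivity)]
    exact h1
  · have h1 : 1 ≤ r⁻¹ * ‖z - w‖ := by rwa [le_inv_mul_iff₀ hr, mul_one]
    have h2 : 0 < ‖z - w‖ := hr.trans_le h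
    rw [max_eq_right h, Real.posLog_eq_log (by rwa [abs_of_nonneg (by positivity)]),
      Real.log_mul (inv_pos.mpr hr).ne' h2.ne', Real.log_inv]
    ring

theorem circleAverage_multiset_sum_log {r : ℝ} (hr : 0 < r) (z : ℂ) (s : Multiset ℂ) :
    CircleIntegrable (fun x => (s.map fun w => Real.log ‖x - w‖).sum) z r ∧
    Real.circleAverage (fun x => (s.map fun w => Real.log ‖x - w‖).sum) z r
      = (s.map fun w => Real.log (max r ‖z - w‖)).sum := by
  induction s using Multiset.induction_on with
  | empty =>
    simp only [Multiset.map_zero, Multiset.sum_zero]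
    exact ⟨circleIntegrable_const 0 z r, Real.circleAverage_const 0 z r⟩
  | cons a s ih =>
    have h : CircleIntegrable (fun x => Real.log ‖x - a‖) z r :=
      circleIntegrable_log_norm_sub_const r
    simp only [Multiset.map_cons, Multiset.sum_cons]
    refine ⟨h.add ih.1, ?_⟩
    rw [← ih.2, ← circleAverage_log_norm_sub_const_eq_log_max hr]
    exact Real.circleAverage_add h ih.1

theorem circleAverage_log_norm_eval {q : ℂ[X]} {z : ℂ} {r : ℝ} (hr : 0 < r)
    (hq : ∀ x ∈ Metric.sphere z r, q.eval x ≠ 0) :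
    CircleIntegrable (fun x => Real.log ‖q.eval x‖) z r ∧
      Real.circleAverage (fun x => Real.log ‖q.eval x‖) z r = jensenSum q z r := by
  have hcont : ContinuousOn (fun x => Real.log ‖q.eval x‖) (Metric.sphere z r) :=
    ContinuousOn.log (by fun_prop) fun x hx => norm_ne_zero_iff.mpr (hq x hx)
  refine ⟨hcont.circleIntegrable hr.le, ?_⟩
  have h := circleAverage_multiset_sum_log hr z q.roots
  rw [jensenSum, ← h.2]
  rw [Real.circleAverage_congr_sphere (f₂ := fun x => Real.log ‖q.leadingCoeff‖
    + (q.roots.map fun w => Real.log ‖x - w‖).sum)]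
  · have h2 := Real.circleAverage_add
      (circleIntegrable_const (Real.log ‖q.leadingCoeff‖) z r) h.1
    rw [Real.circleAverage_const] at h2
    exact h2
  · intro x hx
    rw [abs_of_pos hr] at hx
    exact log_norm_eval (hq x hx)

/-! ### Comparison of `q` and `q - a` where `q` dominates `a`. -/

theorem two_mul_norm_le_of_log_le {a x : ℂ} (hx : x ≠ 0)
    (h : Real.log 2 + Real.posLog ‖a‖ ≤ Real.log ‖x‖) : 2 * ‖a‖ ≤ ‖x‖ := by
  rcases eq_or_ne a 0 with rfl | ha
  · simp
  have ha' : 0 < ‖a‖ := norm_pos_iff.mpr ha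
  have h1 : Real.log ‖a‖ ≤ Real.posLog ‖a‖ := le_max_right _ _
  rw [← Real.log_le_log_iff (by positivity) (norm_pos_iff.mpr hx),
    Real.log_mul two_ne_zero ha'.ne']
  linarith

theorem abs_log_norm_sub_sub_log_norm_le {a x : ℂ} (hx : x ≠ 0) (h : 2 * ‖a‖ ≤ ‖x‖) :
    x - a ≠ 0 ∧ |Real.log ‖x - a‖ - Real.log ‖x‖| ≤ Real.log 2 := by
  have hx' : 0 < ‖x‖ := norm_pos_iff.mpr hx
  have h1 : ‖x‖ ≤ 2 * ‖x - a‖ := by linarith [norm_sub_norm_le x a]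
  have h2 : ‖x - a‖ ≤ 2 * ‖x‖ := by linarith [norm_sub_le x a, norm_nonneg a]
  have h3 : 0 < ‖x - a‖ := by linarith
  refine ⟨norm_pos_iff.mp h3, ?_⟩
  have h4 := Real.log_le_log hx' h1
  have h5 := Real.log_le_log h3 h2
  rw [Real.log_mul two_ne_zero h3.ne'] at h4
  rw [Real.log_mul two_ne_zero hx'.ne'] at h5
  rw [abs_le]
  constructor <;> linarith

/-- Only the values on the circle enter: the two logarithms differ there by at most `log 2`, hence
so do their averages, wherever the roots inside may be. -/
theorem abs_jensenSum_sub_C_sub_le {q : ℂ[X]} {a z : ℂ} {r : ℝ} (hr : 0 < r)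
    (hq : ∀ x ∈ Metric.sphere z r, q.eval x ≠ 0 ∧ 2 * ‖a‖ ≤ ‖q.eval x‖) :
    |jensenSum (q - C a) z r - jensenSum q z r| ≤ Real.log 2 := by
  have hpt : ∀ x ∈ Metric.sphere z r, (q - C a).eval x ≠ 0 ∧
      |Real.log ‖(q - C a).eval x‖ - Real.log ‖q.eval x‖| ≤ Real.log 2 := by
    intro x hx
    rw [eval_sub, eval_C]
    exact abs_log_norm_sub_sub_log_norm_le (hq x hx).1 (hq x hx).2
  have h1 := circleAverage_log_norm_eval hr fun x hx => (hq x hx).1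
  have h2 := circleAverage_log_norm_eval hr fun x hx => (hpt x hx).1
  rw [← h1.2, ← h2.2]
  have h3 := Real.circleAverage_mono h2.1 (h1.1.add (circleIntegrable_const (Real.log 2) z r))
    (fun x hx => by
      rw [abs_of_pos hr] at hx
      have := (abs_le.mp (hpt x hx).2).2
      simp only [Pi.add_apply]
      linarith)
  have h4 := Real.circleAverage_mono h1.1 (h2.1.add (circleIntegrable_const (Real.log 2) z r))
    (fun x hx => by
      rw [abs_of_pos hr] at hx
      have := (abs_le.mp (hpt x hx).2).1
      simp only [Pi.add_apply]
      linarith)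
  rw [Real.circleAverage_add h1.1 (circleIntegrable_const _ _ _), Real.circleAverage_const] at h3
  rw [Real.circleAverage_add h2.1 (circleIntegrable_const _ _ _), Real.circleAverage_const] at h4
  rw [abs_le]
  constructor <;> linarith

/-! ### Root counts from growth of circle averages. -/

open Classical in
/-- The number of roots of `q` in `S`, with multiplicity. -/
noncomputable def rootCount (q : ℂ[X]) (S : Set ℂ) : ℕ := q.roots.countP (· ∈ S)

theorem rootCount_mono (q : ℂ[X]) {S T : Set ℂ} (h : S ⊆ T) : rootCount q S ≤ rootCount q T := by
  classical
  unfold rootCount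
  rw [Multiset.countP_eq_card_filter, Multiset.countP_eq_card_filter]
  exact Multiset.card_le_card (Multiset.monotone_filter_right _ fun _ hx => h hx)

theorem rootCount_congr {q : ℂ[X]} {S T : Set ℂ} (h : ∀ w ∈ q.roots, w ∈ S ↔ w ∈ T) :
    rootCount q S = rootCount q T := by
  unfold rootCount
  revert h
  induction q.roots using Multiset.induction_on with
  | empty => simp
  | cons a s ih =>
    intro h
    rw [Multiset.countP_cons, Multiset.countP_cons,
      ih fun w hw => h w (Multiset.mem_cons_of_mem hw)]
    have ha := h a (Multiset.mem_cons_self a s)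
    by_cases haT : a ∈ T
    · simp [haT, ha.mpr haT]
    · simp [haT, mt ha.mp haT]

theorem rootCount_union_le (q : ℂ[X]) (S T : Set ℂ) :
    rootCount q (S ∪ T) ≤ rootCount q S + rootCount q T := by
  classical
  unfold rootCount
  induction q.roots using Multiset.induction_on with
  | empty => simp
  | cons a s ih =>
    simp only [Multiset.countP_cons]
    by_cases h1 : a ∈ S <;> by_cases h2 : a ∈ T <;> simp [h1, h2] at ih ⊢ <;> omega

theorem rootCount_le_natDegree (q : ℂ[X]) (S : Set ℂ) : rootCount q S ≤ q.natDegree := by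
  classical
  rw [← card_roots_eq_natDegree]
  exact Multiset.countP_le_card _ _

/-- Comparison of a sum over a multiset with the number of elements in a set. -/
theorem countP_mul_le_sum {s : Multiset ℂ} {S : Set ℂ} [DecidablePred (· ∈ S)] {f g : ℂ → ℝ}
    {c d : ℝ} (h1 : ∀ w ∈ S, f w + c + d ≤ g w) (h2 : ∀ w ∉ S, f w + d ≤ g w) :
    (s.map f).sum + (s.countP (· ∈ S) : ℝ) * c + (s.card : ℝ) * d ≤ (s.map g).sum := by
  induction s using Multiset.induction_on with
  | empty => simp
  | cons a s ih =>
    simp only [Multiset.map_cons, Multiset.sum_cons, Multiset.countP_cons, Multiset.card_cons]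
    push_cast
    by_cases h : a ∈ S
    · have := h1 a h
      simp only [h, if_true]
      linarith
    · have := h2 a h
      simp only [h, if_false]
      linarith

/-- As the radius grows from `r₁` to `r₂`, a root in the small disk adds exactly `log (r₂ / r₁)` to
the average, and every other root adds a nonnegative amount. -/
theorem rootCount_mul_le_jensenSum_sub (q : ℂ[X]) (z : ℂ) {r₁ r₂ : ℝ} (hr₁ : 0 < r₁)
    (hr : r₁ ≤ r₂) :
    rootCount q (Metric.closedBall z r₁) * Real.log (r₂ / r₁)
      ≤ jensenSum q z r₂ - jensenSum q z r₁ := by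
  classical
  have hr₂ : 0 < r₂ := hr₁.trans_le hr
  have h := countP_mul_le_sum (s := q.roots) (S := Metric.closedBall z r₁)
    (f := fun w => Real.log (max r₁ ‖z - w‖)) (g := fun w => Real.log (max r₂ ‖z - w‖))
    (c := Real.log (r₂ / r₁)) (d := 0) (fun w hw => ?_) (fun w _ => ?_)
  · have e : rootCount q (Metric.closedBall z r₁)
        = q.roots.countP (· ∈ Metric.closedBall z r₁) := by unfold rootCount; congr!
    rw [e]
    unfold jensenSum
    linarith
  · rw [mem_closedBall_iff_norm'] at hw
    rw [max_eq_left hw, max_eq_left (hw.trans hr), Real.log_div hr₂.ne' hr₁.ne']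
    linarith
  · rw [add_zero]
    exact Real.log_le_log (lt_max_of_lt_left hr₁) (max_le_max_right _ hr)

/-- The converse count: every root adds at most `log (r₂ / r₁)`, and those outside the large disk
add nothing. -/
theorem jensenSum_sub_le_rootCount_mul (q : ℂ[X]) (z : ℂ) {r₁ r₂ : ℝ} (hr₁ : 0 < r₁)
    (hr : r₁ ≤ r₂) :
    jensenSum q z r₂ - jensenSum q z r₁
      ≤ rootCount q (Metric.closedBall z r₂) * Real.log (r₂ / r₁) := by
  classical
  have hr₂ : 0 < r₂ := hr₁.trans_le hr
  have h := countP_mul_le_sum (s := q.roots) (S := Metric.closedBall z r₂)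
    (f := fun w => Real.log (max r₂ ‖z - w‖)) (g := fun w => Real.log (max r₁ ‖z - w‖))
    (c := -Real.log (r₂ / r₁)) (d := 0) (fun w hw => ?_) (fun w hw => ?_)
  · have e : rootCount q (Metric.closedBall z r₂)
        = q.roots.countP (· ∈ Metric.closedBall z r₂) := by unfold rootCount; congr!
    rw [e]
    unfold jensenSum
    linarith
  · rw [mem_closedBall_iff_norm'] at hw
    rw [max_eq_left hw, Real.log_div hr₂.ne' hr₁.ne']
    have := Real.log_le_log hr₁ (le_max_left r₁ ‖z - w‖)
    linarith
  · rw [mem_closedBall_iff_norm', not_le] at hw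
    rw [max_eq_right hw.le, max_eq_right (hr.trans hw.le), add_zero]

/-- On a circle inside the ball of radius `r` that stays at distance `η` from the moduli of the
roots in the ball, `log |q|` is bounded below in terms of the circle average of radius `r`. -/
theorem jensenSum_sub_le_log_norm_eval {q : ℂ[X]} (hq : q ≠ 0) {z x : ℂ} {r s ρ η : ℝ}
    (hs : s < r) (hρ : ρ ≤ s) (hη : 0 < η) (hηr : η ≤ r) (hρ0 : 0 ≤ ρ)
    (hx : x ∈ Metric.sphere z ρ)
    (hroots : ∀ w ∈ q.roots, w ∈ Metric.closedBall z r → η ≤ |‖z - w‖ - ρ|) :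
    q.eval x ≠ 0 ∧ jensenSum q z r + rootCount q (Metric.closedBall z r) * Real.log (η / r)
      + q.natDegree * Real.log (1 - s / r) ≤ Real.log ‖q.eval x‖ := by
  classical
  have hr : 0 < r := hη.trans_le hηr
  rw [Metric.mem_sphere, dist_eq_norm, norm_sub_rev] at hx
  have hdist : ∀ w, |‖z - w‖ - ρ| ≤ ‖x - w‖ := by
    intro w
    rw [← hx]
    refine (abs_norm_sub_norm_le _ _).trans (le_of_eq ?_)
    congr 1
    ring
  have hx0 : q.eval x ≠ 0 := by
    intro h0
    have hmem : x ∈ q.roots := by rw [mem_roots hq]; exact h0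
    have h1 := hroots x hmem (by rw [mem_closedBall_iff_norm', hx]; linarith)
    rw [hx, sub_self, abs_zero] at h1
    linarith
  refine ⟨hx0, ?_⟩
  have hsr : 0 < 1 - s / r := by rw [sub_pos, div_lt_one hr]; exact hs
  have hsr1 : Real.log (1 - s / r) ≤ 0 := by
    refine Real.log_nonpos hsr.le ?_
    linarith [div_nonneg (hρ0.trans hρ) hr.le]
  rw [log_norm_eval hx0, jensenSum]
  have key : ∀ m : Multiset ℂ, (∀ w ∈ m, w ∈ Metric.closedBall z r → η ≤ |‖z - w‖ - ρ|) →
      (m.map fun w => Real.log (max r ‖z - w‖)).sum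
        + (m.countP (· ∈ Metric.closedBall z r) : ℝ) * Real.log (η / r)
        + (m.card : ℝ) * Real.log (1 - s / r) ≤ (m.map fun w => Real.log ‖x - w‖).sum := by
    intro m
    induction m using Multiset.induction_on with
    | empty => simp
    | cons w m ih =>
      intro hm
      have ih' := ih fun w hw => hm w (Multiset.mem_cons_of_mem hw)
      have hw := hm w (Multiset.mem_cons_self w m)
      simp only [Multiset.map_cons, Multiset.sum_cons, Multiset.countP_cons, Multiset.card_cons]
      by_cases hwr : w ∈ Metric.closedBall z r
      · have h1 := (hw hwr).trans (hdist w)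
        have h2 := Real.log_le_log hη h1
        rw [mem_closedBall_iff_norm'] at hwr
        have h3 : max r ‖z - w‖ = r := max_eq_left hwr
        rw [← mem_closedBall_iff_norm'] at hwr
        simp only [hwr, if_true, h3]
        push_cast
        have h4 : Real.log (η / r) = Real.log η - Real.log r := Real.log_div hη.ne' hr.ne'
        linarith
      · have hwr' := hwr
        rw [mem_closedBall_iff_norm', not_le] at hwr'
        have h1 : ‖z - w‖ * (1 - s / r) ≤ ‖x - w‖ := by
          have h5 : s ≤ ‖z - w‖ * (s / r) := by
            rw [mul_div_assoc', le_div_iff₀ hr]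
            nlinarith [hρ0.trans hρ]
          have h6 := (le_abs_self _).trans (hdist w)
          linarith
        have h0 : 0 < ‖z - w‖ := hr.trans hwr'
        have h2 := Real.log_le_log (by positivity) h1
        rw [Real.log_mul h0.ne' hsr.ne'] at h2
        simp only [hwr, if_false, max_eq_right hwr'.le]
        push_cast
        linarith
  have h := key q.roots hroots
  have e : rootCount q (Metric.closedBall z r)
      = q.roots.countP (· ∈ Metric.closedBall z r) := by unfold rootCount; congr!
  rw [card_roots_eq_natDegree] at h
  rw [e]
  linarith

/-- Given at most `m` real numbers, an interval contains a point at controlled distance from all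
of them. -/
theorem exists_mem_Icc_forall_le_abs_sub (T : Finset ℝ) {m : ℕ} (hT : T.card ≤ m) {a b : ℝ}
    (hab : a < b) :
    ∃ ρ ∈ Set.Icc a b, ∀ x ∈ T, (b - a) / (2 * (m + 1)) ≤ |x - ρ| := by
  set h := (b - a) / (2 * (m + 1)) with hh
  have hm : (0 : ℝ) < 2 * (m + 1) := by positivity
  have hpos : 0 < h := div_pos (sub_pos.mpr hab) hm
  have hmul : h * (2 * (m + 1)) = b - a := div_mul_cancel₀ _ hm.ne'
  by_contra! hcon
  -- The `m + 1` test points are the midpoints of the subintervals of length `2h`. A number is at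
  -- distance less than `h` from at most one of them, so by pigeonhole one test point is free.
  have hmem : ∀ i ∈ Finset.range (m + 1), a + h * (2 * i + 1) ∈ Set.Icc a b := by
    intro i hi
    have h1 : (i : ℝ) ≤ m := by exact_mod_cast Nat.lt_succ_iff.mp (Finset.mem_range.mp hi)
    constructor
    · have : 0 ≤ h * (2 * i + 1) := by positivity
      linarith
    · nlinarith
  have hex : ∀ i ∈ Finset.range (m + 1), ∃ x ∈ T, |x - (a + h * (2 * i + 1))| < h :=
    fun i hi => hcon _ (hmem i hi)
  choose! f hfT hf using hex
  have hinj : Set.InjOn f (Finset.range (m + 1) : Set ℕ) := by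
    intro i hi j hj hij
    have h1 := abs_lt.mp (hf i hi)
    have h2 := abs_lt.mp (hf j hj)
    rw [hij] at h1
    by_contra hne
    rcases Nat.lt_or_gt_of_ne hne with hlt | hlt
    · have h3 : (i : ℝ) + 1 ≤ j := by exact_mod_cast hlt
      nlinarith
    · have h3 : (j : ℝ) + 1 ≤ i := by exact_mod_cast hlt
      nlinarith
  have hcard := Finset.card_le_card_of_injOn f (fun i hi => hfT i hi) hinj
  rw [Finset.card_range] at hcard
  omega

theorem natDegree_mul_rootDistribution_eq_rootCount {q : ℂ[X]} (hq : 0 < q.natDegree) {L : Set ℂ}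
    (hL : MeasurableSet L) :
    (q.natDegree : ℝ≥0∞) * rootDistribution q L = (rootCount q L : ℝ≥0∞) := by
  classical
  rw [natDegree_mul_rootDistribution_apply hq hL]
  unfold rootCount
  congr!

/-- If the normalized circle averages of `log |q_k|` tend to a positive limit and the number of
roots of `q_k` in the disk is bounded, subexponential translates of `q_k` have boundedly many
roots in a smaller disk. -/
theorem exists_eventually_rootCount_sub_C_le {q : ℕ → ℂ[X]} (hpos : ∀ k, 0 < (q k).natDegree)
    (hdeg : Tendsto (fun k => (q k).natDegree) atTop atTop) {a : ℕ → ℂ}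
    (ha : Asymptotics.IsLittleO atTop (fun k => Real.posLog ‖a k‖)
      (fun k => ((q k).natDegree : ℝ)))
    {z : ℂ} {r γ : ℝ} (hr : 0 < r) (hγ : 0 < γ) {m : ℕ}
    (hm : ∀ᶠ k in atTop, rootCount (q k) (Metric.closedBall z r) ≤ m)
    (hJ : Tendsto (fun k => 1 / ((q k).natDegree : ℝ) * jensenSum (q k) z r) atTop (𝓝 γ)) :
    ∃ r' > 0, ∃ m' : ℕ, ∀ᶠ k in atTop,
      rootCount (q k - C (a k)) (Metric.ball z r') ≤ m' := by
  classical
  -- The budget: the circle average eventually exceeds `3δn`, roots outside the disk cost `δn` by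
  -- the choice of `s`, and `log⁺ |a_k|` and the terms bounded in `k` take at most `δn/2` each.
  set δ := γ / 4 with hδ
  have hδ0 : 0 < δ := by positivity
  set s := r * (1 - Real.exp (-δ)) with hs
  have hexp1 : Real.exp (-δ) < 1 := Real.exp_zero ▸ Real.exp_lt_exp.mpr (by linarith)
  have hs0 : 0 < s := mul_pos hr (by linarith)
  have hsr : s < r := by nlinarith [Real.exp_pos (-δ)]
  have hlogs : Real.log (1 - s / r) = -δ := by
    rw [hs, mul_div_cancel_left₀ _ hr.ne', sub_sub_cancel, Real.log_exp]
  -- The distance guaranteed by `exists_mem_Icc_forall_le_abs_sub` for at most `m` moduli in an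
  -- interval of length `s / 4`.
  set η := (s / 4) / (2 * (m + 1)) with hη
  have hη0 : 0 < η := by positivity
  have hηr : η ≤ r := by
    have : η ≤ s / 4 := div_le_self (by positivity) (by
      have : (0 : ℝ) ≤ m := m.cast_nonneg
      linarith)
    linarith
  have hlogη : Real.log (η / r) ≤ 0 :=
    Real.log_nonpos (by positivity) ((div_le_one hr).mpr hηr)
  set ℓ := Real.log (3 / 2) with hℓ
  have hℓ0 : 0 < ℓ := Real.log_pos (by norm_num)
  refine ⟨s / 4, by positivity, m + ⌈2 * Real.log 2 / ℓ⌉₊, ?_⟩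
  have hn : Tendsto (fun k => ((q k).natDegree : ℝ)) atTop atTop :=
    tendsto_natCast_atTop_atTop.comp hdeg
  filter_upwards [hm, hJ.eventually_const_lt (show 3 * δ < γ by linarith),
    ha.bound (half_pos hδ0),
    hn.eventually_ge_atTop ((Real.log 2 - m * Real.log (η / r)) / (δ / 2))] with k hmk hJk hak hnk
  set n := ((q k).natDegree : ℝ) with hndef
  have hn0 : 0 < n := Nat.cast_pos.mpr (hpos k)
  have hq0 : q k ≠ 0 := by
    intro h
    have := hpos k
    simp [h] at this
  rw [div_le_iff₀ (by positivity)] at hnk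
  rw [one_div, lt_inv_mul_iff₀ hn0] at hJk
  rw [Real.norm_of_nonneg Real.posLog_nonneg, Real.norm_of_nonneg hn0.le] at hak
  set T := ((q k).roots.filter (· ∈ Metric.closedBall z r)).toFinset.image fun w => ‖z - w‖ with hT
  have hTcard : T.card ≤ m := by
    refine Finset.card_image_le.trans ((Multiset.toFinset_card_le _).trans ?_)
    rw [← Multiset.countP_eq_card_filter]
    refine le_trans (le_of_eq ?_) hmk
    unfold rootCount
    congr!
  have hcircle : ∀ ρ, 0 < ρ → ρ ≤ s → (∀ x ∈ T, η ≤ |x - ρ|) →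
      ∀ x ∈ Metric.sphere z ρ, (q k).eval x ≠ 0 ∧ 2 * ‖a k‖ ≤ ‖(q k).eval x‖ := by
    intro ρ hρ0 hρs hρT x hx
    have h1 := jensenSum_sub_le_log_norm_eval hq0 hsr hρs hη0 hηr hρ0.le hx
      fun w hw hwr => hρT _ (Finset.mem_image_of_mem _ (by
        rw [Multiset.mem_toFinset, Multiset.mem_filter]; exact ⟨hw, hwr⟩))
    refine ⟨h1.1, two_mul_norm_le_of_log_le h1.1 (le_trans ?_ h1.2)⟩
    rw [hlogs]
    have h2 : (m : ℝ) * Real.log (η / r)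
        ≤ rootCount (q k) (Metric.closedBall z r) * Real.log (η / r) :=
      mul_le_mul_of_nonpos_right (by exact_mod_cast hmk) hlogη
    nlinarith
  -- The two radii come from separated intervals, so `ρ₂ / ρ₁ ≥ 3/2`; the gain `L` in Jensen's
  -- formula then has a lower bound `ℓ` independent of `k`.
  obtain ⟨ρ₁, hρ₁, hρ₁T⟩ := exists_mem_Icc_forall_le_abs_sub T hTcard
    (show s / 4 < s / 2 by linarith)
  obtain ⟨ρ₂, hρ₂, hρ₂T⟩ := exists_mem_Icc_forall_le_abs_sub T hTcard
    (show 3 * s / 4 < s by linarith)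
  have e1 : (s / 2 - s / 4) / (2 * (m + 1)) = η := by rw [hη]; congr 1; ring
  have e2 : (s - 3 * s / 4) / (2 * (m + 1)) = η := by rw [hη]; congr 1; ring
  rw [e1] at hρ₁T
  rw [e2] at hρ₂T
  have hρ₁0 : 0 < ρ₁ := lt_of_lt_of_le (by positivity) hρ₁.1
  have hρ₂0 : 0 < ρ₂ := lt_of_lt_of_le (by positivity) hρ₂.1
  have h12 : ρ₁ ≤ ρ₂ := by linarith [hρ₁.2, hρ₂.1]
  have hA1 := abs_le.mp (abs_jensenSum_sub_C_sub_le hρ₁0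
    (hcircle ρ₁ hρ₁0 (by linarith [hρ₁.2]) hρ₁T))
  have hA2 := abs_le.mp (abs_jensenSum_sub_C_sub_le hρ₂0 (hcircle ρ₂ hρ₂0 hρ₂.2 hρ₂T))
  have hf := rootCount_mul_le_jensenSum_sub (q k - C (a k)) z hρ₁0 h12
  have hq := jensenSum_sub_le_rootCount_mul (q k) z hρ₁0 h12
  set L := Real.log (ρ₂ / ρ₁) with hL
  have hLℓ : ℓ ≤ L := by
    refine Real.log_le_log (by norm_num) ?_
    rw [le_div_iff₀ hρ₁0]
    linarith [hρ₁.2, hρ₂.1]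
  have hmono1 : rootCount (q k - C (a k)) (Metric.ball z (s / 4))
      ≤ rootCount (q k - C (a k)) (Metric.closedBall z ρ₁) :=
    rootCount_mono _
      (Metric.ball_subset_closedBall.trans (Metric.closedBall_subset_closedBall hρ₁.1))
  have hmono2 : rootCount (q k) (Metric.closedBall z ρ₂) ≤ m :=
    (rootCount_mono _ (Metric.closedBall_subset_closedBall (hρ₂.2.trans hsr.le))).trans hmk
  refine hmono1.trans ?_
  generalize rootCount (q k - C (a k)) (Metric.closedBall z ρ₁) = N at hf
  have h5 : (rootCount (q k) (Metric.closedBall z ρ₂) : ℝ) ≤ m := by exact_mod_cast hmono2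
  -- Passing from `q_k - a_k` to `q_k` costs `log 2` on each of the two circles.
  have h6 : (N : ℝ) * L ≤ m * L + 2 * Real.log 2 := by nlinarith
  have h7 : (N : ℝ) ≤ m + 2 * Real.log 2 / ℓ := by
    rcases le_total (N : ℝ) m with h | h
    · have : 0 ≤ 2 * Real.log 2 / ℓ := by positivity
      linarith
    · rw [← sub_le_iff_le_add', le_div_iff₀ hℓ0]
      nlinarith
  have h8 : (N : ℝ) ≤ ((m + ⌈2 * Real.log 2 / ℓ⌉₊ : ℕ) : ℝ) := by
    push_cast
    linarith [Nat.le_ceil (2 * Real.log 2 / ℓ)]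
  exact_mod_cast h8

/-- Normalized circle averages of `log |q_k|` off `K` converge to the Green's function. -/
theorem tendsto_inv_natDegree_mul_jensenSum {K : Set ℂ} (hK : IsCompact K)
    (hconn : IsPreconnected Kᶜ) {q : ℕ → ℂ[X]} (hpos : ∀ k, 0 < (q k).natDegree)
    (hdeg : Tendsto (fun k => (q k).natDegree) atTop atTop) (hcenter : CentersOn q K)
    {ω : Measure ℂ} [IsProbabilityMeasure ω] (hω : ω Kᶜ = 0) {I R : ℝ}
    (hKR : K ⊆ Metric.ball 0 R)
    (hzero : ∀ᶠ k in atTop, ∀ z ∈ (Metric.ball (0 : ℂ) R)ᶜ, (q k).eval z ≠ 0)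
    (hunif : TendstoUniformlyOn
      (fun k z => 1 / ((q k).natDegree : ℝ) * Real.log ‖(q k).eval z‖)
      (fun z => realPotential ω z - I) atTop (Metric.ball (0 : ℂ) R)ᶜ)
    {z₀ : ℂ} {r : ℝ} (hr : 0 < r) (hdisj : Disjoint (Metric.closedBall z₀ r) K) :
    Tendsto (fun k => 1 / ((q k).natDegree : ℝ) * jensenSum (q k) z₀ r) atTop
      (𝓝 (realPotential ω z₀ - I)) := by
  obtain ⟨N, -, hN⟩ := hcenter
  have hlead := tendsto_log_leadingCoeff hK hpos hω hzero hunif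
  let μ : ℕ → ProbabilityMeasure ℂ :=
    fun k => ⟨rootDistribution (q k), isProbabilityMeasure_rootDistribution (hpos k)⟩
  have hμR : ∀ᶠ k in atTop, (μ k : Measure ℂ) (Metric.closedBall 0 R)ᶜ = 0 := by
    filter_upwards [hzero] with k hk
    refine rootDistribution_compl_eq_zero measurableSet_closedBall fun z hz => ?_
    by_contra h
    exact hk z (fun hb => h (Metric.ball_subset_closedBall hb)) (isRoot_of_mem_roots hz)
  have hμL : ∀ L : Set ℂ, IsClosed L → Disjoint L K →
      Tendsto (fun k => (μ k : Measure ℂ) L) atTop (𝓝 0) := by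
    intro L hL hLK
    obtain ⟨M, -, hM⟩ := hN L hL hLK
    have h1 : Tendsto (fun k => (M : ℝ≥0∞) / ((q k).natDegree : ℝ≥0∞)) atTop (𝓝 0) :=
      ENNReal.Tendsto.const_div (ENNReal.tendsto_nat_nhds_top.comp hdeg)
        (Or.inr ENNReal.coe_ne_top) |>.trans_eq (by simp)
    refine tendsto_of_tendsto_of_tendsto_of_le_of_le' tendsto_const_nhds h1
      (Eventually.of_forall fun _ => bot_le) ?_
    filter_upwards [eventually_ge_atTop N] with k hk
    rw [ENNReal.le_div_iff_mul_le (Or.inl (by exact_mod_cast (hpos k).ne'))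
      (Or.inl (by finiteness)), mul_comm]
    exact hM k hk
  have hpot : ∀ z : ℂ, R < ‖z‖ →
      Tendsto (fun k => realPotential (μ k) z) atTop (𝓝 (realPotential ω z)) := by
    intro z hz
    have hzR : z ∈ (Metric.ball (0 : ℂ) R)ᶜ := by
      rw [Set.mem_compl_iff, mem_ball_zero_iff]; exact hz.le.not_gt
    have h1 := (hunif.tendsto_at hzR).sub hlead
    rw [sub_neg_eq_add, sub_add_cancel] at h1
    refine h1.congr' ?_
    filter_upwards [hzero] with k hk
    rw [inv_mul_log_norm_eval (hk z hzR), add_sub_cancel_left]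
    rfl
  have h2 := hlead.add (tendsto_integral_log_max hK hconn hω hKR hμR hμL hpot hr hdisj)
  rw [neg_add_eq_sub] at h2
  refine h2.congr fun k => ?_
  change _ + ∫ w, _ ∂(rootDistribution (q k)) = _
  rw [integral_rootDistribution, jensenSum, mul_add, one_div]

/-! ### Regularity and centering of the translates. -/

/-- A positive function off `K` that is continuous and tends to infinity has a positive lower
bound off any ball containing `K`. -/
theorem exists_pos_forall_le_of_tendsto_atTop {K : Set ℂ} {f : ℂ → ℝ} (hf : ContinuousOn f Kᶜ)
    (hpos : ∀ z ∉ K, 0 < f z) (htop : Tendsto f (Bornology.cobounded ℂ) atTop) {R : ℝ}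
    (hKR : K ⊆ Metric.ball 0 R) :
    ∃ δ > 0, ∀ z ∈ (Metric.ball (0 : ℂ) R)ᶜ, δ ≤ f z := by
  have hsub : (Metric.ball (0 : ℂ) R)ᶜ ⊆ Kᶜ := Set.compl_subset_compl.mpr hKR
  set T := {z | z ∈ (Metric.ball (0 : ℂ) R)ᶜ ∧ f z ≤ 1} with hT
  have hTcl : IsClosed T :=
    (hf.mono hsub).preimage_isClosed_of_isClosed Metric.isOpen_ball.isClosed_compl isClosed_Iic
  have hTbd : Bornology.IsBounded T := by
    rw [Bornology.isBounded_def]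
    filter_upwards [htop.eventually_gt_atTop 1] with w hw hwT using absurd hwT.2 (not_le.mpr hw)
  have hTcpt := Metric.isCompact_of_isClosed_isBounded hTcl hTbd
  rcases T.eq_empty_or_nonempty with hemp | hne
  · refine ⟨1, one_pos, fun z hz => ?_⟩
    by_contra! h
    have : z ∈ T := ⟨hz, h.le⟩
    simp [hemp] at this
  · obtain ⟨z₁, hz₁, hmin⟩ := hTcpt.exists_isMinOn hne (hf.mono fun w hw => hsub hw.1)
    refine ⟨min 1 (f z₁), lt_min one_pos (hpos z₁ (hsub hz₁.1)), fun z hz => ?_⟩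
    rcases le_total (f z) 1 with h | h
    · exact (min_le_right _ _).trans (hmin ⟨hz, h⟩)
    · exact (min_le_left _ _).trans h

/-- Subexponential translates of a regular sequence are eventually comparable to it off a disk. -/
theorem eventually_two_mul_norm_le_norm_eval {q : ℕ → ℂ[X]} (hpos : ∀ k, 0 < (q k).natDegree)
    (hdeg : Tendsto (fun k => (q k).natDegree) atTop atTop) {a : ℕ → ℂ}
    (ha : Asymptotics.IsLittleO atTop (fun k => Real.posLog ‖a k‖)
      (fun k => ((q k).natDegree : ℝ))) {S : Set ℂ} {g : ℂ → ℝ} {δ : ℝ} (hδ : 0 < δ)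
    (hg : ∀ z ∈ S, δ ≤ g z)
    (hzero : ∀ᶠ k in atTop, ∀ z ∈ S, (q k).eval z ≠ 0)
    (hunif : TendstoUniformlyOn
      (fun k z => 1 / ((q k).natDegree : ℝ) * Real.log ‖(q k).eval z‖) g atTop S) :
    ∀ᶠ k in atTop, ∀ z ∈ S, (q k).eval z ≠ 0 ∧ 2 * ‖a k‖ ≤ ‖(q k).eval z‖ := by
  have hn : Tendsto (fun k => ((q k).natDegree : ℝ)) atTop atTop :=
    tendsto_natCast_atTop_atTop.comp hdeg
  filter_upwards [hzero, Metric.tendstoUniformlyOn_iff.mp hunif (δ / 2) (half_pos hδ),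
    ha.bound (show 0 < δ / 4 by positivity),
    hn.eventually_ge_atTop (Real.log 2 / (δ / 4))] with k h0 hk hak hnk z hz
  have hn0 : (0 : ℝ) < (q k).natDegree := by exact_mod_cast hpos k
  rw [div_le_iff₀ (by positivity)] at hnk
  rw [Real.norm_of_nonneg Real.posLog_nonneg, Real.norm_of_nonneg hn0.le] at hak
  refine ⟨h0 z hz, two_mul_norm_le_of_log_le (h0 z hz) ?_⟩
  have h1 := hk z hz
  rw [Real.dist_eq] at h1
  have h2 := (abs_lt.mp h1).2
  have h3 : δ / 2 < 1 / ((q k).natDegree : ℝ) * Real.log ‖(q k).eval z‖ := by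
    linarith [hg z hz]
  rw [one_div, lt_inv_mul_iff₀ hn0] at h3
  linarith

theorem tendstoUniformlyOn_sub_C {q : ℕ → ℂ[X]} (hpos : ∀ k, 0 < (q k).natDegree)
    (hdeg : Tendsto (fun k => (q k).natDegree) atTop atTop) {a : ℕ → ℂ} {S : Set ℂ} {g : ℂ → ℝ}
    (hle : ∀ᶠ k in atTop, ∀ z ∈ S, (q k).eval z ≠ 0 ∧ 2 * ‖a k‖ ≤ ‖(q k).eval z‖)
    (hunif : TendstoUniformlyOn
      (fun k z => 1 / ((q k).natDegree : ℝ) * Real.log ‖(q k).eval z‖) g atTop S) :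
    TendstoUniformlyOn (fun k z => 1 / ((q k - C (a k)).natDegree : ℝ)
      * Real.log ‖(q k - C (a k)).eval z‖) g atTop S := by
  have hn : Tendsto (fun k => ((q k).natDegree : ℝ)) atTop atTop :=
    tendsto_natCast_atTop_atTop.comp hdeg
  rw [Metric.tendstoUniformlyOn_iff]
  intro ε hε
  filter_upwards [hle, Metric.tendstoUniformlyOn_iff.mp hunif (ε / 2) (half_pos hε),
    hn.eventually_ge_atTop (Real.log 2 / (ε / 2))] with k hk1 hk2 hnk z hz
  have hn0 : (0 : ℝ) < (q k).natDegree := by exact_mod_cast hpos k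
  rw [div_le_iff₀ (by positivity)] at hnk
  have h1 := (abs_log_norm_sub_sub_log_norm_le (hk1 z hz).1 (hk1 z hz).2).2
  have h2 := hk2 z hz
  rw [natDegree_sub_C, eval_sub, eval_C]
  refine (dist_triangle _ _ _).trans_lt ((add_lt_add_of_lt_of_le h2 ?_).trans_eq (add_halves ε))
  rw [dist_comm, Real.dist_eq, ← mul_sub, abs_mul, abs_of_nonneg (by positivity), one_div,
    inv_mul_le_iff₀ hn0]
  linarith

/-- All roots lie in a fixed disk from `N` on, so only the compact part of `L` in it matters, and
finitely many of the local bounds cover that part. -/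
theorem CentersOn.of_locally_eventually_rootCount_le {K : Set ℂ} {f : ℕ → ℂ[X]}
    (hpos : ∀ k, 0 < (f k).natDegree) {R : ℝ} (hR : 0 < R)
    (hzero : ∀ᶠ k in atTop, ∀ z ∈ (Metric.ball (0 : ℂ) R)ᶜ, (f k).eval z ≠ 0)
    (hloc : ∀ z ∉ K, ∃ r > 0, ∃ m : ℕ, ∀ᶠ k in atTop,
      rootCount (f k) (Metric.ball z r) ≤ m) : CentersOn f K := by
  obtain ⟨N, hN⟩ := eventually_atTop.mp hzero
  have hin : ∀ k ≥ N, ∀ z, (f k).eval z = 0 → z ∈ Metric.ball (0 : ℂ) R := by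
    intro k hk z hz
    by_contra h
    exact hN k hk z h hz
  refine ⟨N, ⟨R, hR, fun k hk z hz => hin k hk z hz⟩, fun L hL hLK => ?_⟩
  have hcpt : IsCompact (L ∩ Metric.closedBall 0 R) := (isCompact_closedBall 0 R).inter_left hL
  have hcount : ∃ m : ℕ, ∀ᶠ k in atTop, rootCount (f k) (L ∩ Metric.closedBall 0 R) ≤ m := by
    refine hcpt.induction_on (p := fun S => ∃ m : ℕ, ∀ᶠ k in atTop, rootCount (f k) S ≤ m)
      ⟨0, Eventually.of_forall fun k => by simp [rootCount]⟩ ?_ ?_ ?_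
    · rintro S T hST ⟨m, hm⟩
      exact ⟨m, hm.mono fun k hk => (rootCount_mono _ hST).trans hk⟩
    · rintro S T ⟨m, hm⟩ ⟨m', hm'⟩
      refine ⟨m + m', ?_⟩
      filter_upwards [hm, hm'] with k hk hk'
      exact (rootCount_union_le _ _ _).trans (add_le_add hk hk')
    · intro z hz
      obtain ⟨r, hr, m, hm⟩ := hloc z (Set.disjoint_left.mp hLK hz.1)
      exact ⟨_, mem_nhdsWithin_of_mem_nhds (Metric.ball_mem_nhds z hr), m, hm⟩
  obtain ⟨m, hm⟩ := hcount
  obtain ⟨N', hN'⟩ := eventually_atTop.mp hm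
  -- The local bounds hold only from `N'` on, whereas centering asks for all `k ≥ N`. The finitely
  -- many remaining indices are absorbed by their degrees, and `+ 1` ensures `M > 0`.
  set M : ℕ := m + ∑ k ∈ Finset.range N', (f k).natDegree + 1 with hM
  refine ⟨M, by rw [hM]; positivity, fun k hk => ?_⟩
  rw [natDegree_mul_rootDistribution_eq_rootCount (hpos k) hL.measurableSet]
  have key : rootCount (f k) L ≤ M := by
    rcases lt_or_ge k N' with h | h
    · have h1 : (f k).natDegree ≤ ∑ k ∈ Finset.range N', (f k).natDegree :=
        Finset.single_le_sum (f := fun k => (f k).natDegree) (fun _ _ => Nat.zero_le _)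
          (Finset.mem_range.mpr h)
      have h2 := rootCount_le_natDegree (f k) L
      omega
    · have h1 : rootCount (f k) L = rootCount (f k) (L ∩ Metric.closedBall 0 R) := by
        refine rootCount_congr fun z hz => ?_
        have h3 := Metric.ball_subset_closedBall (hin k hk z (isRoot_of_mem_roots hz))
        simp only [Set.mem_inter_iff, h3, and_true]
      have h2 := hN' k h
      omega
  exact_mod_cast key

end KRegularFamilies

/-! ### Assembly of the theorem. -/

theorem mainTheorem3 (K : Set ℂ) (hK : IsCompact K) (hKpolar : ¬ IsPolar K)
    (hKconv : IsPolynomiallyConvex K)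
    (q : ℕ → Polynomial ℂ) (hpos : ∀ k, 0 < (q k).natDegree)
    (hdeg : Tendsto (fun k => (q k).natDegree) atTop atTop)
    (a : ℕ → ℂ)
    (ha : Asymptotics.IsLittleO atTop (fun k => Real.posLog ‖a k‖)
      (fun k => ((q k).natDegree : ℝ)))
    (hcenter : CentersOn q K) (hreg : IsKRegular K q) :
    CentersOn (fun k => q k - Polynomial.C (a k)) K ∧
      IsKRegular K (fun k => q k - Polynomial.C (a k)) ∧
      ∀ k, rootDistribution (q k - Polynomial.C (a k)) = valueDistribution (q k) (a k) := by
  have hconn := hKconv.isPreconnected_compl hK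
  obtain ⟨ω, I, hprob, hω, hgreen, hlt⟩ := exists_greenFunction_eq hK hKpolar hconn
  obtain ⟨R, hR, hKR, hzero, hunif⟩ := hreg
  have hsub : (Metric.ball (0 : ℂ) R)ᶜ ⊆ Kᶜ := Set.compl_subset_compl.mpr hKR
  have hunif' := hunif.congr_right fun z hz => hgreen z (hsub hz)
  have hpos' : ∀ k, 0 < (q k - C (a k)).natDegree := fun k => by
    rw [natDegree_sub_C]; exact hpos k
  obtain ⟨δ, hδ, hδle⟩ := exists_pos_forall_le_of_tendsto_atTop
    (f := fun z => realPotential ω z - I)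
    ((harmonicOnNhd_realPotential hK hω).continuousOn.sub continuousOn_const)
    (fun z hz => sub_pos.mpr (hlt z hz))
    (tendsto_atTop_add_const_right _ (-I) (tendsto_realPotential_atTop hK hω)) hKR
  have hle := eventually_two_mul_norm_le_norm_eval hpos hdeg ha hδ hδle hzero hunif'
  have hzero' : ∀ᶠ k in atTop, ∀ z ∈ (Metric.ball (0 : ℂ) R)ᶜ, (q k - C (a k)).eval z ≠ 0 := by
    filter_upwards [hle] with k hk z hz
    rw [eval_sub, eval_C]
    exact (abs_log_norm_sub_sub_log_norm_le (hk z hz).1 (hk z hz).2).1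
  refine ⟨?_, ⟨R, hR, hKR, hzero', tendstoUniformlyOn_sub_C hpos hdeg hle hunif⟩,
    fun k => rootDistribution_sub_C (q k) (hpos k) (a k)⟩
  refine CentersOn.of_locally_eventually_rootCount_le hpos' hR hzero' fun z hz => ?_
  obtain ⟨r, hr, hball⟩ :=
    Metric.nhds_basis_closedBall.mem_iff.mp (hK.isClosed.isOpen_compl.mem_nhds hz)
  have hdisj : Disjoint (Metric.closedBall z r) K := Set.disjoint_left.mpr fun w hw => hball hw
  have hJ := tendsto_inv_natDegree_mul_jensenSum hK hconn hpos hdeg hcenter hω hKR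
    hzero hunif' hr hdisj
  obtain ⟨N, -, hN⟩ := hcenter
  obtain ⟨M, -, hM⟩ := hN _ Metric.isClosed_closedBall hdisj
  refine exists_eventually_rootCount_sub_C_le hpos hdeg ha hr (sub_pos.mpr (hlt z hz))
    (m := ⌈M⌉₊) ?_ hJ
  filter_upwards [eventually_ge_atTop N] with k hk
  have h1 := hM k hk
  rw [natDegree_mul_rootDistribution_eq_rootCount (hpos k) measurableSet_closedBall] at h1
  have h2 : (rootCount (q k) (Metric.closedBall z r) : ℝ≥0) ≤ M := by exact_mod_cast h1
  exact_mod_cast h2.trans (Nat.le_ceil M)
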